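/- **Setting.** Fix $\kappa\in(0,1)$. For $n=\kappa m$ let $A = U P S\in\mathbb R^{m\times n}$, where $U$ is an $m\times m$ orthogonal matrix (fixed or random), $P$ is a uniformly random $m\times m$ permutation matrix, and $S=\begin{bmatrix} I_n\\ 0_{m-n,n}\end{bmatrix}$ selects the first $n$ columns. Let $x\sim N(0,I_n/\kappa)$, with $U$, $P$, $x$ independent. Put $$\Psi = AA^{\mathsf T}-\kappa I_m,\qquad z=Ax,\qquad Z=\mathrm{diag}(z_1,\dots,z_m).$$ The model is called *sub-sampled Haar* if $U$ is Haar distributed on the orthogonal group $\mathbb O(m)$, and *sub-sampled Hadamard* if $m=2^\ell$ and $U=H$ is the Hadamard–Walsh matrix $H_{ij}=(-1)^{\langle \boldsymbol i,\boldsymbol j\rangle}/\sqrt m$, where $\boldsymbol i,\boldsymbol j\in\{0,1\}^\ell$ are the binary representations of $i-1,j-1$. **Alternating products.** Let $k\ge 1$, let $p_1,\dots,p_k$ be real polynomials with $\mathbb E\,p_i(B-\kappa)=0$ for $B\sim\mathrm{Bern}(\kappa)$, and let $q_1,\dots,q_k:\mathbb R\to\mathbb R$ be bounded, Lipschitz,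 even functions with $\mathbb E\,q_i(\xi)=0$ for $\xi\sim N(0,1)$. An alternating product $\mathcal A(\Psi,Z)$ is one of 1. $p_1(\Psi)q_1(Z)p_2(\Psi)\cdots q_{k-1}(Z)p_k(\Psi)$, 2. $p_1(\Psi)q_1(Z)p_2(\Psi)q_2(Z)\cdots p_k(\Psi)q_k(Z)$, 3. $q_1(Z)p_2(\Psi)q_2(Z)\cdots p_k(\Psi)q_k(Z)$, 4. $q_1(Z)p_2(\Psi)q_2(Z)p_3(\Psi)\cdots q_{k-1}(Z)p_k(\Psi)$ (here $k\ge2$), where $p_i(\Psi)$ is the usual matrix polynomial and $q_i(Z)=\mathrm{diag}(q_i(z_1),\dots,q_i(z_m))$. The number $k$, the $p_i$, the $q_i$ and the type do not depend on $m$. **Proposition 3.1.** Let $\mathcal A(\Psi,Z)$ be an alternating product. Suppose that $A$ is generated from the sub-sampled Haar model, or from the sub-sampled Hadamard model, or by sub-sampling deterministic orthogonal matrices $U$ (one for each $m$) with $$\|U\|_\infty=\max_{i,j}|U_{ij}|\le\sqrt{\frac{K_1\log^{K_2}(m)}{m}}\qquad\text{for all } m\ge K_3,$$ for some fixed constants $K_1,K_2,K_3$.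 Then, as $m\to\infty$ with $n=\kappa m$, $$\frac{\mathrm{Tr}\,\mathcal A(\Psi,Z)}{m}\xrightarrow{\ P\ }0 .$$ -/

import Mathlib

open MeasureTheory ProbabilityTheory Filter Topology
open scoped Matrix Polynomial NNReal

noncomputable section

/-! ### Alternating products -/

/-- The expectation `E f(B)` for a Bernoulli variable `B` with `P(B = 1) = κ`, `P(B = 0) = 1 - κ`. -/
def bernoulliExpectation (κ : ℝ) (f : ℝ → ℝ) : ℝ := κ * f 1 + (1 - κ) * f 0

/-- `E p(B - κ) = 0` for `B ∼ Bern(κ)`. -/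
def CenteredPolynomial (κ : ℝ) (p : ℝ[X]) : Prop :=
  bernoulliExpectation κ (fun b => p.eval (b - κ)) = 0

/-- Bounded Lipschitz even functions `q` with `E q(ξ) = 0` for `ξ ∼ N(0, 1)`. -/
structure CenteredEvenFunction (q : ℝ → ℝ) : Prop where
  bounded : ∃ C : ℝ, ∀ ξ, |q ξ| ≤ C
  lipschitz : ∃ L : ℝ≥0, LipschitzWith L q
  even : ∀ ξ, q (-ξ) = q ξ
  centered : ∫ ξ, q ξ ∂(gaussianReal 0 1) = 0

/-- The four shapes of an alternating product. -/
inductive AlternatingType where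
  | one
  | two
  | three
  | four

/-- The formula of an alternating product: its type, its length parameter `k`, and the
polynomials `p 1, …, p k` and functions `q 1, …, q k`. A product of type four with `k = 1` would
have no factor at all, so there `k ≥ 2`. -/
structure AlternatingProduct (κ : ℝ) where
  type : AlternatingType
  k : ℕ
  p : ℕ → ℝ[X]
  q : ℕ → ℝ → ℝ
  one_le_k : 1 ≤ k
  two_le_k : type = .four → 2 ≤ k
  centered_p : ∀ i, 1 ≤ i → i ≤ k → CenteredPolynomial κ (p i)
  centered_q : ∀ i, 1 ≤ i → i ≤ k → CenteredEvenFunction (q i)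

/-- `q(Z)` for a diagonal matrix `Z`: the function acts on the diagonal entries. -/
def diagApply {m : ℕ} (q : ℝ → ℝ) (Z : Matrix (Fin m) (Fin m) ℝ) : Matrix (Fin m) (Fin m) ℝ :=
  Matrix.diagonal fun i => q (Z i i)

/-- The matrix `𝒜(Ψ, Z)`. Here `List.range' 1 r` is the list `[1, 2, …, r]`, and `List.prod` is the
ordered product. -/
def AlternatingProduct.eval {κ : ℝ} (𝒜 : AlternatingProduct κ) {m : ℕ}
    (Ψ Z : Matrix (Fin m) (Fin m) ℝ) : Matrix (Fin m) (Fin m) ℝ :=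
  let P : ℕ → Matrix (Fin m) (Fin m) ℝ := fun i => Polynomial.aeval Ψ (𝒜.p i)
  let Q : ℕ → Matrix (Fin m) (Fin m) ℝ := fun i => diagApply (𝒜.q i) Z
  match 𝒜.type with
  | .one => P 1 * ((List.range' 1 (𝒜.k - 1)).map fun i => Q i * P (i + 1)).prod
  | .two => ((List.range' 1 𝒜.k).map fun i => P i * Q i).prod
  | .three => Q 1 * ((List.range' 1 (𝒜.k - 1)).map fun i => P (i + 1) * Q (i + 1)).prod
  | .four => ((List.range' 1 (𝒜.k - 1)).map fun i => Q i * P (i + 1)).prod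

/-! ### Sensing models -/

/-- The group of `m × m` real orthogonal matrices. -/
abbrev OrthogonalMatrix (m : ℕ) : Type := Matrix.orthogonalGroup (Fin m) ℝ

instance instMeasurableSpaceOrthogonalMatrix (m : ℕ) : MeasurableSpace (OrthogonalMatrix m) :=
  borel _

instance instBorelSpaceOrthogonalMatrix (m : ℕ) : BorelSpace (OrthogonalMatrix m) := ⟨rfl⟩

instance instMeasurableSpacePerm (m : ℕ) : MeasurableSpace (Equiv.Perm (Fin m)) := ⊤

instance instCompactSpaceOrthogonalMatrix (m : ℕ) : CompactSpace (OrthogonalMatrix m) := by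
  have hc : IsCompact (Set.univ.pi fun _ : Fin m => Set.univ.pi fun _ : Fin m =>
      Metric.closedBall (0 : ℝ) 1) :=
    isCompact_univ_pi fun _ => isCompact_univ_pi fun _ => isCompact_closedBall 0 1
  have hcl : IsClosed ((Matrix.orthogonalGroup (Fin m) ℝ : Set (Matrix (Fin m) (Fin m) ℝ))) :=
    isClosed_unitary
  refine isCompact_iff_compactSpace.mp (hc.of_isClosed_subset hcl ?_)
  intro U hU i _ j _
  simpa using entry_norm_bound_of_unitary (𝕜 := ℝ) hU i j

/-- The Haar probability measure on the orthogonal group. -/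
def haarOrthogonal (m : ℕ) : Measure (OrthogonalMatrix m) := Measure.haarMeasure ⊤

/-- The inner product `⟨i, j⟩` of the `ℓ`-bit binary representations of `i` and `j`. -/
def bitInner (ℓ i j : ℕ) : ℕ := ∑ b ∈ Finset.range ℓ, (i.testBit b).toNat * (j.testBit b).toNat

/-- The `2 ^ ℓ × 2 ^ ℓ` Hadamard-Walsh matrix, rows and columns numbered from `0`. -/
def hadamardWalsh (ℓ : ℕ) : Matrix (Fin (2 ^ ℓ)) (Fin (2 ^ ℓ)) ℝ :=
  Matrix.of fun i j => (-1) ^ bitInner ℓ i j / √((2 ^ ℓ : ℕ) : ℝ)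

theorem hadamardWalsh_mem_orthogonalGroup (ℓ : ℕ) :
    hadamardWalsh ℓ ∈ Matrix.orthogonalGroup (Fin (2 ^ ℓ)) ℝ := by
  rw [Matrix.mem_orthogonalGroup_iff]
  have hpos : (0 : ℝ) < ((2 ^ ℓ : ℕ) : ℝ) := by positivity
  have hs : √((2 ^ ℓ : ℕ) : ℝ) * √((2 ^ ℓ : ℕ) : ℝ) = ((2 ^ ℓ : ℕ) : ℝ) :=
    Real.mul_self_sqrt hpos.le
  have hentry : ∀ i j k : Fin (2 ^ ℓ), hadamardWalsh ℓ i k * hadamardWalsh ℓ j k =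
      ((-1) ^ bitInner ℓ i k * (-1) ^ bitInner ℓ j k) / ((2 ^ ℓ : ℕ) : ℝ) := by
    intro i j k
    simp only [hadamardWalsh, Matrix.of_apply]
    rw [div_mul_div_comm, hs]
  ext i j
  rw [Matrix.mul_apply]
  have hterm : ∀ k, hadamardWalsh ℓ i k * (hadamardWalsh ℓ)ᵀ k j =
      ((-1) ^ bitInner ℓ i k * (-1) ^ bitInner ℓ j k) / ((2 ^ ℓ : ℕ) : ℝ) := by
    intro k
    rw [Matrix.transpose_apply, hentry]
  rw [Finset.sum_congr rfl fun k _ => hterm k, ← Finset.sum_div]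
  by_cases hij : i = j
  · subst hij
    simp only [← mul_pow, mul_neg, mul_one, neg_neg, one_pow, Matrix.one_apply_eq]
    rw [Finset.sum_const, Finset.card_univ, Fintype.card_fin, nsmul_eq_mul, mul_one,
      div_self hpos.ne']
  · rw [Matrix.one_apply_ne hij]
    obtain ⟨b, hb⟩ : ∃ b, (i : ℕ).testBit b ≠ (j : ℕ).testBit b := by
      by_contra! h
      exact hij (Fin.ext (Nat.eq_of_testBit_eq h))
    have hbl : b < ℓ := by
      by_contra! h
      have h2 : 2 ^ ℓ ≤ 2 ^ b := Nat.pow_le_pow_right (by norm_num) h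
      exact hb (by rw [Nat.testBit_lt_two_pow (i.2.trans_le h2),
        Nat.testBit_lt_two_pow (j.2.trans_le h2)])
    have hlt : ∀ k : Fin (2 ^ ℓ), (k : ℕ) ^^^ 2 ^ b < 2 ^ ℓ := fun k =>
      Nat.xor_lt_two_pow k.2 (Nat.pow_lt_pow_right (by norm_num) hbl)
    have hprod : ∀ i k : ℕ, ((-1 : ℝ)) ^ bitInner ℓ i k =
        (-1) ^ ((i.testBit b).toNat * (k.testBit b).toNat) *
          ∏ c ∈ (Finset.range ℓ).erase b,
            (-1 : ℝ) ^ ((i.testBit c).toNat * (k.testBit c).toNat) := by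
      intro i k
      rw [bitInner, ← Finset.prod_pow_eq_pow_sum]
      exact (Finset.mul_prod_erase (Finset.range ℓ)
        (fun c => (-1 : ℝ) ^ ((i.testBit c).toNat * (k.testBit c).toNat))
        (Finset.mem_range.mpr hbl)).symm
    have hflip : ∀ i k : ℕ, ((-1 : ℝ)) ^ bitInner ℓ i (k ^^^ 2 ^ b) =
        (-1) ^ (i.testBit b).toNat * (-1) ^ bitInner ℓ i k := by
      intro i k
      rw [hprod i, hprod i, ← mul_assoc]
      congr 1
      · rw [Nat.testBit_xor, Nat.testBit_two_pow_self]
        cases i.testBit b <;> cases k.testBit b <;> simp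
      · refine Finset.prod_congr rfl fun c hc => ?_
        have : b ≠ c := (Finset.ne_of_mem_erase hc).symm
        rw [Nat.testBit_xor, Nat.testBit_two_pow_of_ne this, Bool.xor_false]
    have hsum : ∑ k : Fin (2 ^ ℓ), ((-1 : ℝ) ^ bitInner ℓ i k * (-1) ^ bitInner ℓ j k) = 0 := by
      refine Finset.sum_involution (fun k _ => ⟨(k : ℕ) ^^^ 2 ^ b, hlt k⟩) ?_ ?_ ?_ ?_
      · intro k _
        simp only [hflip]
        cases hi : (i : ℕ).testBit b <;> cases hj : (j : ℕ).testBit b <;>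
          simp_all
      · intro k _ _ h
        have h1 := congrArg (fun a : Fin (2 ^ ℓ) => (a : ℕ).testBit b) h
        simp [Nat.testBit_xor, Nat.testBit_two_pow_self] at h1
      · intro k _
        exact Finset.mem_univ _
      · intro k _
        exact Fin.ext (by simp)
    rw [hsum, zero_div]

/-- The Hadamard-Walsh matrix as an element of the orthogonal group. -/
def hadamardOrthogonal (ℓ : ℕ) : OrthogonalMatrix (2 ^ ℓ) :=
  ⟨hadamardWalsh ℓ, hadamardWalsh_mem_orthogonalGroup ℓ⟩

/-- The selection matrix with the block form `[I_n ; 0]` (for `n ≤ m`). -/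
def selectionMatrix (m n : ℕ) : Matrix (Fin m) (Fin n) ℝ :=
  Matrix.of fun i j => if (i : ℕ) = (j : ℕ) then 1 else 0

/-- A realization of the randomness: the orthogonal matrix `U`, the permutation defining `P`, and
the signal `x ∈ ℝ^n`. -/
structure Realization (m n : ℕ) where
  U : OrthogonalMatrix m
  perm : Equiv.Perm (Fin m)
  x : Fin n → ℝ

namespace Realization

variable {m n : ℕ}

/-- The sensing matrix `A = U P S`. -/
def A (ω : Realization m n) : Matrix (Fin m) (Fin n) ℝ :=
  (ω.U : Matrix (Fin m) (Fin m) ℝ) * ω.perm.permMatrix ℝ * selectionMatrix m n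

/-- `Ψ = A Aᵀ - κ I`. -/
def Ψ (κ : ℝ) (ω : Realization m n) : Matrix (Fin m) (Fin m) ℝ :=
  ω.A * ω.Aᵀ - κ • (1 : Matrix (Fin m) (Fin m) ℝ)

/-- `Z = diag(A x)`. -/
def Z (ω : Realization m n) : Matrix (Fin m) (Fin m) ℝ := Matrix.diagonal (ω.A *ᵥ ω.x)

end Realization

/-- The joint law of `(U, permutation, x)` in the sub-sampled orthogonal model: the three are
independent, `U ∼ ν`, the permutation is uniform, and `x ∼ N(0, I_n / κ)`. -/
def modelLaw (κ : ℝ) (m n : ℕ) (ν : Measure (OrthogonalMatrix m)) :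
    Measure (OrthogonalMatrix m × Equiv.Perm (Fin m) × (Fin n → ℝ)) :=
  ν.prod ((uniformOn (Set.univ : Set (Equiv.Perm (Fin m)))).prod
    (Measure.pi fun _ : Fin n => gaussianReal 0 (Real.toNNReal (1 / κ))))

/-- `Tr 𝒜(Ψ, Z) / m → 0` in probability along a sequence of dimensions `m j, n j`, when `U` has
law `ν j` in the `j`-th model. -/
def NormalizedTraceTendsToZero {κ : ℝ} (𝒜 : AlternatingProduct κ) (m n : ℕ → ℕ)
    (ν : ∀ j, Measure (OrthogonalMatrix (m j))) : Prop :=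
  ∀ ε : ℝ, 0 < ε → Tendsto (fun j => modelLaw κ (m j) (n j) (ν j)
    {s | let ω : Realization (m j) (n j) := ⟨s.1, s.2.1, s.2.2⟩
      ε ≤ |(𝒜.eval (ω.Ψ κ) ω.Z).trace / (m j : ℝ)|}) atTop (𝓝 0)

end

/-! ### Gaussian vectors and products of even functions -/

/-! The matrix `A * Aᵀ` is a projection, so a centered polynomial of `Ψ` is a scalar multiple of `Ψ`
(`aeval_sub_smul_one_of_idempotent`). The trace thus becomes a sum over index maps of weights, which
are products of entries of `Ψ`, times products of functions of the `z i`, nearly all centered and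
even (`AlternatingProduct.exists_trace_eval_eq`).

Fix a delocalized `U`. Concentration for a random permutation bounds all entries of `Ψ` by `ε`, of
order `m ^ (2δ - 1/2)`, with high probability (`prob_exists_le_abs_Ψ_le`). Given `U` and the
permutation, `z` is Gaussian with covariance `I + Ψ/κ`, so its coordinates are almost independent.
In the mean of a product, every centered even factor whose coordinate occurs only once gains a
factor `ε`: centering removes the leading term and evenness the linear one
(`exists_gaussian_prod_bound`).

The second moment of the trace is a sum over `2N` indices. Few distinct indices mean few terms,
while many distinct indices mean many that occur once, hence many gained factors. With the powers of
`ε` in the weights, an index map with `d` distinct values contributes `O(ε ^ (2d - 2))`, and the sum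
is `O(ε⁻² (2N + m ε²) ^ (2N))` (`exists_second_moment_bound`). For small `δ` this is `o(m²)`, and
Chebyshev's inequality concludes (`AlternatingProduct.exists_prob_bound`).

All three models are delocalized: the last two by their entry bounds, the Haar model because left
invariance allows multiplication by a flat orthogonal matrix with random column signs, which turns
each entry into a Rademacher sum (`haarOrthogonal_exists_entry_le`). -/

theorem integral_cexp_sum_pi_gaussianReal {J : Type*} [Fintype J] (v : ℝ≥0) (c : J → ℝ) :
    ∫ x : J → ℝ, Complex.exp (((∑ j, c j * x j : ℝ) : ℂ) * Complex.I)
      ∂(Measure.pi fun _ => gaussianReal 0 v) = Complex.exp (-((v * ∑ j, c j ^ 2 / 2 : ℝ) : ℂ)) := by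
  have h1 : ∀ x : J → ℝ, Complex.exp (((∑ j, c j * x j : ℝ) : ℂ) * Complex.I) =
      ∏ j, Complex.exp (c j * x j * Complex.I) := by
    intro x
    rw [← Complex.exp_sum]
    push_cast
    rw [Finset.sum_mul]
  simp_rw [h1]
  rw [integral_fintype_prod_eq_prod (fun j (y : ℝ) => Complex.exp (c j * y * Complex.I))]
  simp_rw [← charFun_apply_real, charFun_gaussianReal]
  rw [← Complex.exp_sum]
  congr 1
  push_cast
  rw [Finset.mul_sum, ← Finset.sum_neg_distrib]
  refine Finset.sum_congr rfl fun j _ => ?_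
  ring

theorem measure_ext_of_integral_cexp {R : Type*} [Fintype R] {μ ν : Measure (R → ℝ)}
    [IsFiniteMeasure μ] [IsFiniteMeasure ν]
    (h : ∀ t : R → ℝ, ∫ y, Complex.exp (((∑ a, t a * y a : ℝ) : ℂ) * Complex.I) ∂μ =
      ∫ y, Complex.exp (((∑ a, t a * y a : ℝ) : ℂ) * Complex.I) ∂ν) : μ = ν := by
  classical
  refine Measure.ext_of_charFunDual (funext fun ℓ => ?_)
  have hl : ∀ y : R → ℝ, ℓ y = ∑ a, ℓ (Pi.single a 1) * y a := by
    intro y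
    conv_lhs => rw [← Finset.univ_sum_single y]
    rw [map_sum]
    refine Finset.sum_congr rfl fun a _ => ?_
    rw [mul_comm, ← smul_eq_mul, ← map_smul, ← Pi.single_smul, smul_eq_mul, mul_one]
  have := h fun a => ℓ (Pi.single a 1)
  simp_rw [← hl] at this
  rw [charFunDual_apply, charFunDual_apply]
  exact this

theorem integral_cexp_mulVec {R J : Type*} [Fintype R] [Fintype J] (v : ℝ≥0)
    (L : Matrix R J ℝ) (t : R → ℝ) :
    ∫ x : J → ℝ, Complex.exp (((∑ a, t a * (L *ᵥ x) a : ℝ) : ℂ) * Complex.I)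
      ∂(Measure.pi fun _ => gaussianReal 0 v) =
      Complex.exp (-((t ⬝ᵥ (((v : ℝ) • (L * Lᵀ)) *ᵥ t) / 2 : ℝ) : ℂ)) := by
  have h1 : ∀ x : J → ℝ, ∑ a, t a * (L *ᵥ x) a = ∑ j, (t ᵥ* L) j * x j := fun x =>
    Matrix.dotProduct_mulVec t L x
  simp_rw [h1]
  rw [integral_cexp_sum_pi_gaussianReal]
  congr 3
  rw [Matrix.smul_mulVec, dotProduct_smul, ← Matrix.mulVec_mulVec, Matrix.dotProduct_mulVec,
    Matrix.mulVec_transpose, ← Finset.sum_div, smul_eq_mul, mul_div_assoc]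
  simp only [dotProduct, sq]

/-- A centered Gaussian vector whose covariance is `σ² I + B Bᵀ` is the sum of independent
Gaussian vectors with these covariances. -/
theorem map_mulVec_pi_gaussianReal {R J : Type*} [Fintype R] [DecidableEq R] [Fintype J]
    (v : ℝ≥0) (L : Matrix R J ℝ) (B : Matrix R R ℝ) (σ : ℝ)
    (h : (v : ℝ) • (L * Lᵀ) = σ ^ 2 • (1 : Matrix R R ℝ) + B * Bᵀ) :
    (Measure.pi fun _ : J => gaussianReal 0 v).map (fun x => L *ᵥ x) =
      ((Measure.pi fun _ : R => gaussianReal 0 1).prod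
        (Measure.pi fun _ : R => gaussianReal 0 1)).map
        (fun g => fun a => (B *ᵥ g.1) a + σ * g.2 a) := by
  have hL : Measurable fun x : J → ℝ => L *ᵥ x := by
    unfold Matrix.mulVec dotProduct; fun_prop
  have hB : Measurable fun g : (R → ℝ) × (R → ℝ) => fun a => (B *ᵥ g.1) a + σ * g.2 a := by
    unfold Matrix.mulVec dotProduct; fun_prop
  have := Measure.isProbabilityMeasure_map (μ := Measure.pi fun _ : J => gaussianReal 0 v)
    hL.aemeasurable
  have := Measure.isProbabilityMeasure_map (μ := (Measure.pi fun _ : R => gaussianReal 0 1).prod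
        (Measure.pi fun _ : R => gaussianReal 0 1)) hB.aemeasurable
  refine measure_ext_of_integral_cexp fun t => ?_
  have hE : Measurable fun y : R → ℝ =>
      Complex.exp (((∑ a, t a * y a : ℝ) : ℂ) * Complex.I) := by
    refine Continuous.measurable ?_
    fun_prop
  rw [integral_map hL.aemeasurable hE.aestronglyMeasurable,
    integral_map hB.aemeasurable hE.aestronglyMeasurable,
    integral_cexp_mulVec, h]
  have h1 : ∀ g : (R → ℝ) × (R → ℝ), Complex.exp
      (((∑ a, t a * ((B *ᵥ g.1) a + σ * g.2 a) : ℝ) : ℂ) * Complex.I) =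
      Complex.exp (((∑ a, t a * (B *ᵥ g.1) a : ℝ) : ℂ) * Complex.I) *
      Complex.exp (((∑ a, t a * ((σ • (1 : Matrix R R ℝ)) *ᵥ g.2) a : ℝ) : ℂ) * Complex.I) := by
    intro g
    rw [← Complex.exp_add, ← add_mul, ← Complex.ofReal_add, ← Finset.sum_add_distrib]
    simp only [Matrix.smul_mulVec, Matrix.one_mulVec, Pi.smul_apply, smul_eq_mul, mul_add]
  simp_rw [h1]
  rw [integral_prod_mul (fun g : R → ℝ =>
      Complex.exp (((∑ a, t a * (B *ᵥ g) a : ℝ) : ℂ) * Complex.I))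
    (fun g : R → ℝ => Complex.exp
      (((∑ a, t a * ((σ • (1 : Matrix R R ℝ)) *ᵥ g) a : ℝ) : ℂ) * Complex.I)),
    integral_cexp_mulVec, integral_cexp_mulVec, ← Complex.exp_add, ← neg_add,
    ← Complex.ofReal_add, ← add_div, ← dotProduct_add, ← Matrix.add_mulVec]
  rw [add_comm]
  simp [smul_smul, sq]

/-! ### One-dimensional Gaussian means of even functions. -/

theorem integral_abs_gaussianReal_le_one : ∫ x, |x| ∂(gaussianReal 0 1) ≤ 1 := by
  have h2 : Integrable (fun x : ℝ => x ^ 2) (gaussianReal 0 1) :=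
    (memLp_id_gaussianReal 2).integrable_sq
  have h1 : Integrable (fun x : ℝ => x) (gaussianReal 0 1) :=
    (memLp_id_gaussianReal 1).integrable (by simp)
  have hv : ∫ x, x ^ 2 ∂(gaussianReal 0 1) = 1 := by
    have := variance_fun_id_gaussianReal (μ := 0) (v := 1)
    rw [variance_eq_integral (by fun_prop), integral_id_gaussianReal] at this
    simpa using this
  calc ∫ x, |x| ∂(gaussianReal 0 1) ≤ ∫ x, (1 + x ^ 2) / 2 ∂(gaussianReal 0 1) := by
        refine integral_mono h1.abs (((integrable_const _).add h2).div_const 2) fun x => ?_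
        have := sq_nonneg (|x| - 1)
        simp only
        nlinarith [sq_abs x]
    _ = 1 := by
        rw [integral_div, integral_add (integrable_const _) h2, hv]
        simp

theorem integrable_of_bounded_measurable {Ω : Type*} [MeasurableSpace Ω] {μ : Measure Ω}
    [IsFiniteMeasure μ] {f : Ω → ℝ} (hf : Measurable f) {C : ℝ} (hC : ∀ x, |f x| ≤ C) :
    Integrable f μ :=
  Integrable.of_bound hf.aestronglyMeasurable C (ae_of_all _ hC)

/-- The Cameron-Martin formula for a standard Gaussian variable. -/
theorem integral_comp_add_gaussianReal (f : ℝ → ℝ) (a : ℝ) :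
    ∫ x, f (x + a) ∂(gaussianReal 0 1) =
      ∫ x, f x * Real.exp (a * x - a ^ 2 / 2) ∂(gaussianReal 0 1) := by
  have h1 : ∫ x, f (x + a) ∂(gaussianReal 0 1) = ∫ x, f x ∂(gaussianReal a 1) := by
    rw [← zero_add a, ← gaussianReal_map_add_const, zero_add,
      (measurableEmbedding_addRight a).integral_map]
  rw [h1, integral_gaussianReal_eq_integral_smul one_ne_zero,
    integral_gaussianReal_eq_integral_smul one_ne_zero]
  congr 1
  ext x
  simp only [gaussianPDFReal, smul_eq_mul, NNReal.coe_one, mul_one, sub_zero]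
  rw [mul_assoc, mul_assoc, mul_left_comm (Real.exp _) (f x), ← Real.exp_add, mul_comm (f x)]
  congr 3
  ring

theorem integrable_exp_linear_gaussianReal (a b : ℝ) :
    Integrable (fun x => Real.exp (a * x - b)) (gaussianReal 0 1) := by
  simp_rw [sub_eq_add_neg, Real.exp_add]
  exact (integrable_exp_mul_gaussianReal a).mul_const _

theorem integral_exp_mul_gaussianReal (a : ℝ) :
    ∫ x, Real.exp (a * x) ∂(gaussianReal 0 1) = Real.exp (a ^ 2 / 2) := by
  have := congrFun (mgf_fun_id_gaussianReal (μ := 0) (v := 1)) a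
  simpa [mgf] using this

theorem integrable_cosh_gaussianReal (a : ℝ) :
    Integrable (fun x => Real.cosh (a * x)) (gaussianReal 0 1) := by
  simp_rw [Real.cosh_eq]
  refine ((integrable_exp_mul_gaussianReal a).add ?_).div_const 2
  simpa using integrable_exp_mul_gaussianReal (μ := 0) (v := 1) (-a)

theorem integral_cosh_gaussianReal (a : ℝ) :
    ∫ x, Real.cosh (a * x) ∂(gaussianReal 0 1) = Real.exp (a ^ 2 / 2) := by
  simp_rw [Real.cosh_eq, ← neg_mul]
  rw [integral_div, integral_add (integrable_exp_mul_gaussianReal a)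
    (integrable_exp_mul_gaussianReal (-a)), integral_exp_mul_gaussianReal,
    integral_exp_mul_gaussianReal]
  ring_nf

/-- As `cosh ≥ 1` and `e ≤ 1`, the integrand is at most `(cosh * e - e) + (1 - e)`. The mean of
`cosh * e` is `1`, which leaves `2 * (1 - e) ≤ a ^ 2`. -/
theorem integral_abs_cosh_sub_one_le (a : ℝ) :
    ∫ x, |Real.cosh (a * x) * Real.exp (-(a ^ 2 / 2)) - 1| ∂(gaussianReal 0 1) ≤ a ^ 2 := by
  set e := Real.exp (-(a ^ 2 / 2)) with he
  have he0 : 0 < e := Real.exp_pos _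
  have he1 : e ≤ 1 := Real.exp_le_one_iff.2 (by nlinarith [sq_nonneg a])
  have hi := integrable_cosh_gaussianReal a
  calc ∫ x, |Real.cosh (a * x) * e - 1| ∂(gaussianReal 0 1)
      ≤ ∫ x, (Real.cosh (a * x) * e + (1 - 2 * e)) ∂(gaussianReal 0 1) := by
        refine integral_mono ((hi.mul_const _).sub (integrable_const _)).abs
          ((hi.mul_const _).add (integrable_const _)) fun x => ?_
        have := Real.one_le_cosh (a * x)
        simp only [abs_le]
        constructor <;> nlinarith
    _ = 2 * (1 - e) := by
        rw [integral_add (hi.mul_const _) (integrable_const _), integral_mul_const,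
          integral_cosh_gaussianReal, he, ← Real.exp_add]
        simp; ring
    _ ≤ a ^ 2 := by
        have := Real.add_one_le_exp (-(a ^ 2 / 2))
        linarith

/-- Shifting the argument of a bounded even function by `a` changes its Gaussian mean by
`O(a ^ 2)`. -/
theorem abs_integral_shift_sub_le {f : ℝ → ℝ} (hf : Measurable f) {B : ℝ}
    (hB : ∀ x, |f x| ≤ B) (heven : ∀ x, f (-x) = f x) (a : ℝ) :
    |∫ x, f (x + a) ∂(gaussianReal 0 1) - ∫ x, f x ∂(gaussianReal 0 1)| ≤ B * a ^ 2 := by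
  have hint : ∀ b : ℝ, Integrable (fun x => f x * Real.exp (b * x - b ^ 2 / 2))
      (gaussianReal 0 1) := fun b =>
    (integrable_exp_linear_gaussianReal b _).bdd_mul hf.aestronglyMeasurable (ae_of_all _ hB)
  -- Evenness makes the shifts by `a` and `-a` equivalent. Averaging their two Cameron-Martin
  -- densities gives a `cosh`, which has no term linear in `a`.
  have hneg : ∫ x, f (x + a) ∂(gaussianReal 0 1) = ∫ x, f (x + -a) ∂(gaussianReal 0 1) := by
    have h0 : gaussianReal 0 1 = (gaussianReal 0 1).map (fun x => -x) := by
      rw [gaussianReal_map_neg, neg_zero]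
    have hm : Measurable fun x => f (x + -a) := by fun_prop
    conv_rhs => rw [h0, integral_map (by fun_prop) hm.aestronglyMeasurable]
    refine integral_congr_ae (ae_of_all _ fun x => ?_)
    simp only
    rw [← heven]; congr 1; ring
  have key : ∫ x, f (x + a) ∂(gaussianReal 0 1) - ∫ x, f x ∂(gaussianReal 0 1) =
      ∫ x, f x * (Real.cosh (a * x) * Real.exp (-(a ^ 2 / 2)) - 1) ∂(gaussianReal 0 1) := by
    have h2 : ∫ x, f (x + a) ∂(gaussianReal 0 1) =
        ∫ x, (f x * Real.exp (a * x - a ^ 2 / 2) +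
          f x * Real.exp (-a * x - (-a) ^ 2 / 2)) / 2 ∂(gaussianReal 0 1) := by
      rw [integral_div, integral_add (hint a) (hint (-a)), ← integral_comp_add_gaussianReal,
        ← integral_comp_add_gaussianReal, ← hneg]
      ring
    have hs : Integrable (fun x => (f x * Real.exp (a * x - a ^ 2 / 2) +
          f x * Real.exp (-a * x - (-a) ^ 2 / 2)) / 2) (gaussianReal 0 1) :=
      ((hint a).add (hint (-a))).div_const 2
    rw [h2, ← integral_sub hs (integrable_of_bounded_measurable hf hB)]
    refine integral_congr_ae (ae_of_all _ fun x => ?_)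
    simp only [Real.cosh_eq, sub_eq_add_neg, Real.exp_add]
    ring_nf
  rw [key]
  calc _ ≤ ∫ x, |f x * (Real.cosh (a * x) * Real.exp (-(a ^ 2 / 2)) - 1)| ∂(gaussianReal 0 1) :=
        abs_integral_le_integral_abs
    _ ≤ ∫ x, B * |Real.cosh (a * x) * Real.exp (-(a ^ 2 / 2)) - 1| ∂(gaussianReal 0 1) := by
        have hi : Integrable (fun x => Real.cosh (a * x) * Real.exp (-(a ^ 2 / 2)) - 1)
          (gaussianReal 0 1) := ((integrable_cosh_gaussianReal a).mul_const _).sub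
            (integrable_const _)
        refine integral_mono (hi.bdd_mul hf.aestronglyMeasurable (ae_of_all _ hB)).abs
          (hi.abs.const_mul B) fun x => ?_
        simp only [abs_mul]
        exact mul_le_mul_of_nonneg_right (hB x) (abs_nonneg _)
    _ ≤ B * a ^ 2 := by
        rw [integral_const_mul]
        exact mul_le_mul_of_nonneg_left (integral_abs_cosh_sub_one_le a)
          ((abs_nonneg _).trans (hB 0))

/-- The change of scale costs `|σ - 1|` by the Lipschitz bound and centering; the shift costs only
its square, by evenness. -/
theorem abs_integral_centered_perturbation_le {f : ℝ → ℝ} {B : ℝ} (hB : ∀ x, |f x| ≤ B)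
    {K : ℝ≥0} (hK : LipschitzWith K f) (heven : ∀ x, f (-x) = f x)
    (hc : ∫ x, f x ∂(gaussianReal 0 1) = 0) {σ : ℝ} (hσ : 0 < σ) (y : ℝ) :
    |∫ x, f (y + σ * x) ∂(gaussianReal 0 1)| ≤ K * |σ - 1| + B * (y / σ) ^ 2 := by
  have hf : Measurable f := hK.continuous.measurable
  have h1 := abs_integral_shift_sub_le (f := fun x => f (σ * x)) (by fun_prop)
    (fun x => hB _) (fun x => by rw [mul_neg, heven]) (y / σ)
  have h2 : ∀ x, σ * (x + y / σ) = y + σ * x := fun x => by field_simp; ring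
  simp only [h2] at h1
  have h3 : |∫ x, f (σ * x) ∂(gaussianReal 0 1)| ≤ K * |σ - 1| := by
    have hx : Integrable (fun x : ℝ => x) (gaussianReal 0 1) :=
      (memLp_id_gaussianReal 1).integrable (by simp)
    have i1 : Integrable (fun x => f (σ * x)) (gaussianReal 0 1) :=
      integrable_of_bounded_measurable (by fun_prop) fun x => hB _
    have i2 := integrable_of_bounded_measurable (μ := gaussianReal 0 1) hf hB
    have : ∫ x, f (σ * x) ∂(gaussianReal 0 1) =
        ∫ x, (f (σ * x) - f x) ∂(gaussianReal 0 1) := by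
      rw [integral_sub i1 i2, hc, sub_zero]
    rw [this]
    calc _ ≤ ∫ x, |f (σ * x) - f x| ∂(gaussianReal 0 1) := abs_integral_le_integral_abs
      _ ≤ ∫ x, K * |σ - 1| * |x| ∂(gaussianReal 0 1) := by
          refine integral_mono (i1.sub i2).abs (hx.abs.const_mul _) fun x => ?_
          have := hK.dist_le_mul (σ * x) x
          rw [Real.dist_eq, Real.dist_eq] at this
          simp only
          rwa [mul_assoc, ← abs_mul, sub_one_mul]
      _ ≤ K * |σ - 1| := by
          rw [integral_const_mul]
          exact mul_le_of_le_one_right (by positivity) integral_abs_gaussianReal_le_one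
  have := abs_add_le (∫ x, f (y + σ * x) ∂(gaussianReal 0 1) - ∫ x, f (σ * x) ∂(gaussianReal 0 1))
    (∫ x, f (σ * x) ∂(gaussianReal 0 1))
  rw [sub_add_cancel] at this
  linarith

/-! ### Products over the coordinates of a nearly isotropic Gaussian vector. -/

theorem map_dotProduct_pi_gaussianReal {J : Type*} [Fintype J] (c : J → ℝ) :
    (Measure.pi fun _ : J => gaussianReal 0 1).map (fun g => c ⬝ᵥ g) =
      gaussianReal 0 (∑ j, c j ^ 2).toNNReal := by
  have hm : Measurable fun g : J → ℝ => c ⬝ᵥ g := by unfold dotProduct; fun_prop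
  have := Measure.isProbabilityMeasure_map (μ := Measure.pi fun _ : J => gaussianReal 0 1)
    hm.aemeasurable
  refine Measure.ext_of_charFun (funext fun t => ?_)
  have hE : Measurable fun y : ℝ => Complex.exp (t * y * Complex.I) :=
    Continuous.measurable (by fun_prop)
  rw [charFun_gaussianReal, charFun_apply_real, integral_map hm.aemeasurable
    hE.aestronglyMeasurable]
  have h1 : ∀ g : J → ℝ, (t : ℂ) * ((c ⬝ᵥ g : ℝ) : ℂ) = ((∑ j, (t * c j) * g j : ℝ) : ℂ) := by
    intro g
    rw [← Complex.ofReal_mul, dotProduct, Finset.mul_sum]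
    simp only [mul_assoc]
  simp_rw [h1]
  rw [integral_cexp_sum_pi_gaussianReal, Real.coe_toNNReal _ (by positivity)]
  congr 1
  push_cast
  simp only [mul_pow, mul_zero, zero_mul, zero_sub, one_mul, ← Finset.sum_div, ← Finset.mul_sum]
  ring

theorem exists_mul_transpose_of_posSemidef {R : Type*} [Fintype R] [DecidableEq R]
    {S : Matrix R R ℝ} (hS : S.PosSemidef) : ∃ B : Matrix R R ℝ, B * Bᵀ = S := by
  open scoped MatrixOrder in
  refine ⟨CFC.sqrt S, ?_⟩
  open scoped MatrixOrder in
  have h : (CFC.sqrt S)ᵀ = CFC.sqrt S := by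
    have := (CFC.sqrt_nonneg S).isSelfAdjoint.star_eq
    rwa [Matrix.star_eq_conjTranspose, Matrix.conjTranspose_eq_transpose_of_trivial] at this
  open scoped MatrixOrder in
  rw [h, CFC.sqrt_mul_sqrt_self _ hS.nonneg]

/-- By `|x a| |x b| ≤ (x a ^ 2 + x b ^ 2) / 2`, the quadratic form of `E` is at most `card R * ε`
times the squared length. -/
theorem posSemidef_add_smul_one_of_abs_le {R : Type*} [Fintype R] [DecidableEq R]
    {E : Matrix R R ℝ} (hE : Eᵀ = E) {ε c : ℝ} (hε : ∀ a b, |E a b| ≤ ε)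
    (hc : Fintype.card R * ε ≤ c) : (E + c • (1 : Matrix R R ℝ)).PosSemidef := by
  refine .of_dotProduct_mulVec_nonneg ?_ fun x => ?_
  · rw [Matrix.IsHermitian, Matrix.conjTranspose_eq_transpose_of_trivial]
    simp [hE]
  · rw [star_trivial, Matrix.add_mulVec, dotProduct_add, Matrix.smul_mulVec, Matrix.one_mulVec,
      dotProduct_smul, smul_eq_mul]
    have h1 : |x ⬝ᵥ (E *ᵥ x)| ≤ ∑ a, ∑ b, (ε * (x a ^ 2 + x b ^ 2) / 2) := by
      simp only [dotProduct, Matrix.mulVec, Finset.mul_sum]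
      refine (Finset.abs_sum_le_sum_abs _ _).trans (Finset.sum_le_sum fun a _ => ?_)
      refine (Finset.abs_sum_le_sum_abs _ _).trans (Finset.sum_le_sum fun b _ => ?_)
      rw [abs_mul, abs_mul]
      have h2 := hε a b
      have h3 : |x a| * |x b| ≤ (x a ^ 2 + x b ^ 2) / 2 := by
        have := sq_nonneg (|x a| - |x b|)
        nlinarith [sq_abs (x a), sq_abs (x b)]
      calc |x a| * (|E a b| * |x b|) = |E a b| * (|x a| * |x b|) := by ring
        _ ≤ ε * ((x a ^ 2 + x b ^ 2) / 2) :=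
          mul_le_mul h2 h3 (by positivity) ((abs_nonneg _).trans h2)
        _ = _ := by ring
    have h4 : ∑ a, ∑ b, (ε * (x a ^ 2 + x b ^ 2) / 2) = Fintype.card R * ε * (x ⬝ᵥ x) := by
      simp only [mul_add, add_div, Finset.sum_add_distrib, Finset.sum_const, Finset.card_univ,
        nsmul_eq_mul, ← Finset.mul_sum, ← Finset.sum_div, dotProduct, ← sq]
      ring
    have h5 : 0 ≤ x ⬝ᵥ x := Finset.sum_nonneg fun a _ => mul_self_nonneg _
    have h6 := neg_abs_le (x ⬝ᵥ (E *ᵥ x))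
    nlinarith

/-- Comparing with the largest factor replaces a joint moment of correlated variables by
one-dimensional moments. -/
theorem prod_le_one_add_sum_pow {R : Type*} (U : Finset R) {y : R → ℝ} (hy : ∀ a, 1 ≤ y a)
    {M : ℕ} (hM : U.card ≤ M) : ∏ a ∈ U, y a ≤ 1 + ∑ a ∈ U, y a ^ M := by
  rcases U.eq_empty_or_nonempty with rfl | hU
  · simp
  obtain ⟨b, hb, hmax⟩ := U.exists_max_image y hU
  have h0 : ∀ a, 0 ≤ y a := fun a => zero_le_one.trans (hy a)
  calc ∏ a ∈ U, y a ≤ y b ^ U.card := by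
        rw [← Finset.prod_const]
        exact Finset.prod_le_prod (fun a _ => h0 a) hmax
    _ ≤ y b ^ M := pow_le_pow_right₀ (hy b) hM
    _ ≤ ∑ a ∈ U, y a ^ M :=
      Finset.single_le_sum (f := fun a => y a ^ M) (fun a _ => pow_nonneg (h0 a) _) hb
    _ ≤ _ := by linarith

theorem integrable_one_add_mul_sq_pow (c : ℝ) (M : ℕ) (v : ℝ≥0) :
    Integrable (fun x : ℝ => (1 + c * x ^ 2) ^ M) (gaussianReal 0 v) := by
  simp_rw [add_comm (1 : ℝ), add_pow, one_pow, mul_one, mul_pow, ← pow_mul]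
  refine integrable_finsetSum _ fun k _ => ((Integrable.const_mul ?_ _).mul_const _)
  have := (memLp_id_gaussianReal (μ := 0) (v := v) (2 * k : ℕ)).integrable_norm_pow'
  simpa [pow_mul] using this

/-- Only the product `c * v` matters. It will be applied with `c = ε⁻¹` and a variance of order `ε`,
giving a bound uniform in `ε`. -/
theorem integral_one_add_mul_sq_pow_le {c : ℝ} (hc : 0 ≤ c) (M : ℕ) {v : ℝ} (hv : 0 ≤ v)
    {D : ℝ} (hD : c * v ≤ D) :
    ∫ x, (1 + c * x ^ 2) ^ M ∂(gaussianReal 0 v.toNNReal) ≤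
      ∫ x, (1 + D * x ^ 2) ^ M ∂(gaussianReal 0 1) := by
  have h : gaussianReal 0 v.toNNReal = (gaussianReal 0 1).map (fun x => √v * x) := by
    rw [gaussianReal_map_const_mul]
    congr 1
    · simp
    · ext
      simp [hv, Real.sq_sqrt]
  have hm : Measurable fun x : ℝ => (1 + c * x ^ 2) ^ M := by fun_prop
  have hi := integrable_one_add_mul_sq_pow c M v.toNNReal
  rw [h] at hi ⊢
  rw [integral_map (by fun_prop) hm.aestronglyMeasurable]
  rw [integrable_map_measure hm.aestronglyMeasurable (by fun_prop)] at hi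
  refine integral_mono hi (integrable_one_add_mul_sq_pow D M 1) fun x => ?_
  simp only [mul_pow, Real.sq_sqrt hv, ← mul_assoc]
  gcongr

/-- The mean of a product of bounded functions of the coordinates of a Gaussian vector with
covariance `I + O(ε)` gains a factor `ε` for each factor which is centered, even and Lipschitz. -/
theorem exists_gaussian_prod_bound (M : ℕ) (B : ℝ) (K : ℝ≥0) : ∃ C : ℝ, 0 ≤ C ∧
    ∀ (R J : Type) [Fintype R] [DecidableEq R] [Fintype J] (v : ℝ≥0) (L : Matrix R J ℝ) (ε : ℝ)
      (h : R → ℝ → ℝ) (U : Finset R), 0 < ε → Fintype.card R ≤ M → M * ε ≤ 1 / 2 →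
      (∀ a b, |((v : ℝ) • (L * Lᵀ) - 1 : Matrix R R ℝ) a b| ≤ ε) → (∀ a, Measurable (h a)) →
      (∀ a x, |h a x| ≤ B) → (∀ a ∈ U, LipschitzWith K (h a)) →
      (∀ a ∈ U, ∀ x, h a (-x) = h a x) → (∀ a ∈ U, ∫ x, h a x ∂(gaussianReal 0 1) = 0) →
      |∫ x, ∏ a, h a ((L *ᵥ x) a) ∂(Measure.pi fun _ : J => gaussianReal 0 v)| ≤
        C * ε ^ U.card := by
  set D : ℝ := max 1 (K * M + 2 * |B|) with hD
  have hD1 : 1 ≤ D := le_max_left _ _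
  have hD2 : K * M + 2 * |B| ≤ D := le_max_right _ _
  set A : ℝ := ∫ x, (1 + (M + 1 : ℝ) * x ^ 2) ^ M ∂(gaussianReal 0 1) with hA
  have hA0 : 0 ≤ A := integral_nonneg fun x => by positivity
  refine ⟨D ^ M * (1 + M * A), by positivity, ?_⟩
  intro R J _ _ _ v L ε h U hε hR hMε hE hm hB hLip heven hcent
  have hR' : (Fintype.card R : ℝ) ≤ M := by exact_mod_cast hR
  -- With `E` the deviation of the covariance from `1`, write `1 + E = σ ^ 2 • 1 + (E + M * ε • 1)`.
  -- The last matrix is positive semidefinite, so the vector is `S g` plus independent coordinates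
  -- of variance `σ ^ 2`; given `g`, the mean of the product factorizes.
  set σ := √(1 - M * ε) with hσ
  have hσ2 : σ ^ 2 = 1 - M * ε := Real.sq_sqrt (by linarith)
  have hMε0 : 0 ≤ M * ε := by positivity
  have hσ0 : 0 < σ := Real.sqrt_pos.2 (by linarith)
  have hσ1 : σ ≤ 1 := Real.sqrt_le_one.2 (by linarith)
  have hσd : |σ - 1| ≤ M * ε := by
    rw [abs_of_nonpos (by linarith)]
    nlinarith
  have hsym : ((v : ℝ) • (L * Lᵀ) - 1)ᵀ = (v : ℝ) • (L * Lᵀ) - 1 := by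
    simp [Matrix.transpose_sub, Matrix.transpose_mul]
  have hps := posSemidef_add_smul_one_of_abs_le hsym hE
    (c := M * ε) (mul_le_mul_of_nonneg_right hR' hε.le)
  obtain ⟨S, hS⟩ := exists_mul_transpose_of_posSemidef hps
  have hdiag : ∀ a, ∑ j, S a j ^ 2 ≤ (M + 1) * ε := by
    intro a
    have h1 := congrFun (congrFun hS a) a
    rw [Matrix.mul_apply] at h1
    simp only [Matrix.transpose_apply, ← sq] at h1
    rw [h1]
    have := (abs_le.1 (hE a a)).2
    simp only [Matrix.add_apply, Matrix.smul_apply, Matrix.one_apply_eq, smul_eq_mul] at this ⊢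
    linarith
  have hmap := map_mulVec_pi_gaussianReal v L S σ (by
    rw [hS, hσ2, sub_smul, one_smul]; abel)
  have hprodm : Measurable fun y : R → ℝ => ∏ a, h a (y a) :=
    Finset.measurable_prod _ fun a _ => (hm a).comp (measurable_pi_apply a)
  have hLm : Measurable fun x : J → ℝ => L *ᵥ x := by
    unfold Matrix.mulVec dotProduct; fun_prop
  have hSm : Measurable fun g : (R → ℝ) × (R → ℝ) => fun a => (S *ᵥ g.1) a + σ * g.2 a := by
    unfold Matrix.mulVec dotProduct; fun_prop
  have habs : ∀ y : R → ℝ, |∏ a, h a (y a)| ≤ |B| ^ Fintype.card R := by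
    intro y
    rw [Finset.abs_prod, ← Finset.card_univ, ← Finset.prod_const]
    exact Finset.prod_le_prod (fun _ _ => abs_nonneg _) fun a _ =>
      (hB a _).trans (le_abs_self B)
  have hint : ∫ x, ∏ a, h a ((L *ᵥ x) a) ∂(Measure.pi fun _ : J => gaussianReal 0 v) =
      ∫ g, ∏ a, (∫ x, h a ((S *ᵥ g) a + σ * x) ∂(gaussianReal 0 1))
        ∂(Measure.pi fun _ : R => gaussianReal 0 1) := by
    have hi : Integrable (fun g : (R → ℝ) × (R → ℝ) => ∏ a, h a ((S *ᵥ g.1) a + σ * g.2 a))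
        ((Measure.pi fun _ : R => gaussianReal 0 1).prod
          (Measure.pi fun _ : R => gaussianReal 0 1)) :=
      integrable_of_bounded_measurable (hprodm.comp hSm) fun g => habs _
    rw [← integral_map (f := fun y : R → ℝ => ∏ a, h a (y a)) hLm.aemeasurable
      hprodm.aestronglyMeasurable, hmap, integral_map hSm.aemeasurable
      hprodm.aestronglyMeasurable, integral_prod _ hi]
    refine integral_congr_ae (ae_of_all _ fun g => ?_)
    exact integral_fintype_prod_eq_prod (fun a x => h a ((S *ᵥ g) a + σ * x))
  -- The shift `(S *ᵥ g) a` has variance at most `(M + 1) * ε`, so its square is `ε` times a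
  -- variable of order one. Factors outside `U` are only bounded.
  have hfac : ∀ (g : R → ℝ) (a : R), |∫ x, h a ((S *ᵥ g) a + σ * x) ∂(gaussianReal 0 1)| ≤
      D * (if a ∈ U then ε * (1 + ε⁻¹ * (S *ᵥ g) a ^ 2) else 1) := by
    intro g a
    split_ifs with ha
    · refine (abs_integral_centered_perturbation_le (fun x => (hB a x).trans (le_abs_self B))
        (hLip a ha) (heven a ha) (hcent a ha) hσ0 _).trans ?_
      set w := (S *ᵥ g) a
      have h1 : (w / σ) ^ 2 ≤ 2 * w ^ 2 := by
        rw [div_pow, hσ2, div_le_iff₀ (by linarith)]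
        nlinarith [sq_nonneg w]
      have h2 : D * (ε * (1 + ε⁻¹ * w ^ 2)) = D * ε + D * w ^ 2 := by
        field_simp
      rw [h2]
      have h3 : (K : ℝ) * |σ - 1| ≤ K * M * ε := by
        rw [mul_assoc]; exact mul_le_mul_of_nonneg_left hσd K.2
      have h4 : |B| * (w / σ) ^ 2 ≤ 2 * |B| * w ^ 2 := by
        have := mul_le_mul_of_nonneg_left h1 (abs_nonneg B)
        linarith
      have h5 : 0 ≤ (K : ℝ) * M := by positivity
      have h6 : K * M * ε ≤ D * ε := by
        gcongr; linarith [abs_nonneg B]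
      have h7 : 2 * |B| * w ^ 2 ≤ D * w ^ 2 := by
        gcongr; linarith
      linarith
    · rw [mul_one]
      have := norm_integral_le_of_norm_le_const (μ := gaussianReal 0 1)
        (f := fun x => h a ((S *ᵥ g) a + σ * x)) (C := B)
        (ae_of_all _ fun x => hB a ((S *ᵥ g) a + σ * x))
      simp only [Real.norm_eq_abs, probReal_univ, mul_one] at this
      have h5 : 0 ≤ (K : ℝ) * M := by positivity
      linarith [le_abs_self B, abs_nonneg B]
  have hprod : ∀ g : R → ℝ, |∏ a, (∫ x, h a ((S *ᵥ g) a + σ * x) ∂(gaussianReal 0 1))| ≤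
      D ^ M * ε ^ U.card * (1 + ∑ a ∈ U, (1 + ε⁻¹ * (S *ᵥ g) a ^ 2) ^ M) := by
    intro g
    rw [Finset.abs_prod]
    refine (Finset.prod_le_prod (fun _ _ => abs_nonneg _) fun a _ => hfac g a).trans ?_
    rw [Finset.prod_mul_distrib, Finset.prod_const, Finset.prod_ite_mem, Finset.univ_inter,
      Finset.prod_mul_distrib, Finset.prod_const, mul_assoc]
    refine mul_le_mul (pow_le_pow_right₀ hD1 hR) ?_ ?_ (by positivity)
    · refine mul_le_mul_of_nonneg_left ?_ (by positivity)
      refine prod_le_one_add_sum_pow U (fun a => ?_) (U.card_le_univ.trans hR)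
      have : 0 ≤ ε⁻¹ * (S *ᵥ g) a ^ 2 := by positivity
      linarith
    · exact mul_nonneg (by positivity) (Finset.prod_nonneg fun a _ => by positivity)
  have hpm : Measurable fun x : ℝ => (1 + ε⁻¹ * x ^ 2) ^ M := by fun_prop
  have hcm : ∀ a, Measurable fun g : R → ℝ => S a ⬝ᵥ g := by
    intro a; unfold dotProduct; fun_prop
  have hqi : ∀ a, Integrable (fun g : R → ℝ => (1 + ε⁻¹ * (S *ᵥ g) a ^ 2) ^ M)
      (Measure.pi fun _ : R => gaussianReal 0 1) := by
    intro a
    have := integrable_one_add_mul_sq_pow ε⁻¹ M (∑ j, S a j ^ 2).toNNReal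
    rw [← map_dotProduct_pi_gaussianReal, integrable_map_measure hpm.aestronglyMeasurable
      (hcm a).aemeasurable] at this
    exact this
  have hq : ∀ a, ∫ g : R → ℝ, (1 + ε⁻¹ * (S *ᵥ g) a ^ 2) ^ M
      ∂(Measure.pi fun _ : R => gaussianReal 0 1) ≤ A := by
    intro a
    have h1 := integral_one_add_mul_sq_pow_le (inv_nonneg.2 hε.le) M
      (v := ∑ j, S a j ^ 2) (by positivity) (D := M + 1) (by
        rw [inv_mul_le_iff₀ hε, mul_comm]; exact hdiag a)
    rw [← map_dotProduct_pi_gaussianReal, integral_map (hcm a).aemeasurable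
      hpm.aestronglyMeasurable] at h1
    exact h1
  rw [hint]
  calc _ ≤ ∫ g, |∏ a, (∫ x, h a ((S *ᵥ g) a + σ * x) ∂(gaussianReal 0 1))|
        ∂(Measure.pi fun _ : R => gaussianReal 0 1) := abs_integral_le_integral_abs
    _ ≤ ∫ g, D ^ M * ε ^ U.card * (1 + ∑ a ∈ U, (1 + ε⁻¹ * (S *ᵥ g) a ^ 2) ^ M)
        ∂(Measure.pi fun _ : R => gaussianReal 0 1) := by
        refine integral_mono_of_nonneg (ae_of_all _ fun g => abs_nonneg _) ?_
          (ae_of_all _ hprod)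
        exact ((integrable_const _).add (integrable_finsetSum _ fun a _ => hqi a)).const_mul _
    _ = D ^ M * ε ^ U.card * (1 + ∑ a ∈ U, ∫ g : R → ℝ, (1 + ε⁻¹ * (S *ᵥ g) a ^ 2) ^ M
        ∂(Measure.pi fun _ : R => gaussianReal 0 1)) := by
        rw [integral_const_mul, integral_add (integrable_const _)
          (integrable_finsetSum _ fun a _ => hqi a), integral_finsetSum _ fun a _ => hqi a]
        simp
    _ ≤ D ^ M * ε ^ U.card * (1 + M * A) := by
        gcongr
        refine (Finset.sum_le_card_nsmul U _ A fun a _ => hq a).trans ?_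
        rw [nsmul_eq_mul]
        have : (U.card : ℝ) ≤ M := by exact_mod_cast U.card_le_univ.trans hR
        gcongr
    _ = _ := by ring

/-! ### Second moments of sums over index maps -/

/-- Choose the values one at a time: a new value either repeats one of at most `M` earlier ones or
costs a factor `x`. -/
theorem sum_pow_card_image_fin_le {α : Type*} [Fintype α] [DecidableEq α] {x : ℝ} (hx : 0 ≤ x)
    (M : ℕ) : ∑ v : Fin M → α, x ^ (Finset.univ.image v).card ≤ (M + Fintype.card α * x) ^ M := by
  induction M with
  | zero => simp
  | succ M ih =>
    have himage : ∀ (a : α) (v : Fin M → α), Finset.univ.image (Fin.cons a v : Fin (M + 1) → α) =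
        insert a (Finset.univ.image v) := by
      intro a v
      ext b
      simp [Fin.exists_fin_succ, eq_comm]
    have hstep : ∀ v : Fin M → α, ∑ a, x ^ (insert a (Finset.univ.image v)).card ≤
        (M + Fintype.card α * x) * x ^ (Finset.univ.image v).card := by
      intro v
      set S := Finset.univ.image v with hS
      have hSM : S.card ≤ M := by simpa using Finset.card_image_le (s := Finset.univ) (f := v)
      have h1 : ∀ a, x ^ (insert a S).card ≤ (if a ∈ S then x ^ S.card else 0) + x * x ^ S.card := by
        intro a
        by_cases ha : a ∈ S
        · rw [Finset.insert_eq_of_mem ha, if_pos ha]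
          have : 0 ≤ x * x ^ S.card := by positivity
          linarith
        · rw [Finset.card_insert_of_notMem ha, if_neg ha, pow_succ']
          simp
      refine (Finset.sum_le_sum fun a _ => h1 a).trans ?_
      rw [Finset.sum_add_distrib, Finset.sum_ite_mem, Finset.univ_inter, Finset.sum_const,
        Finset.sum_const, Finset.card_univ, nsmul_eq_mul, nsmul_eq_mul, ← mul_assoc, ← add_mul]
      gcongr
    rw [← (Fin.consEquiv fun _ => α).sum_comp, Fintype.sum_prod_type, Finset.sum_comm]
    have hc : ∀ (a : α) (v : Fin M → α), (Fin.consEquiv fun _ => α) (a, v) = Fin.cons a v :=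
      fun a v => rfl
    simp_rw [hc, himage]
    calc _ ≤ ∑ v : Fin M → α, (M + Fintype.card α * x) * x ^ (Finset.univ.image v).card :=
          Finset.sum_le_sum fun v _ => hstep v
      _ ≤ (M + Fintype.card α * x) * (M + Fintype.card α * x) ^ M := by
          rw [← Finset.mul_sum]
          exact mul_le_mul_of_nonneg_left ih (by positivity)
      _ ≤ ((M + 1 : ℕ) + Fintype.card α * x) ^ (M + 1) := by
          rw [← pow_succ']
          push_cast
          gcongr
          linarith

theorem sum_pow_card_image_le {ι α : Type*} [Fintype ι] [DecidableEq ι] [Fintype α]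
    [DecidableEq α] {x : ℝ} (hx : 0 ≤ x) :
    ∑ v : ι → α, x ^ (Finset.univ.image v).card ≤
      (Fintype.card ι + Fintype.card α * x) ^ Fintype.card ι := by
  refine le_trans (le_of_eq ?_) (sum_pow_card_image_fin_le hx (Fintype.card ι))
  refine Fintype.sum_equiv ((Fintype.equivFin ι).arrowCongr (Equiv.refl α)) _ _ fun v => ?_
  congr 2
  ext a
  simp only [Finset.mem_image, Finset.mem_univ, true_and]
  constructor
  · rintro ⟨l, rfl⟩
    exact ⟨Fintype.equivFin ι l, by simp⟩
  · rintro ⟨l, rfl⟩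
    exact ⟨(Fintype.equivFin ι).symm l, by simp⟩

/-- If `v` is onto, then most of its values are taken only once, or the target is small. -/
theorem two_mul_card_le_of_surjective {ι R : Type*} [Fintype ι] [DecidableEq ι] [Fintype R]
    [DecidableEq R] (v : ι → R) (hv : Function.Surjective v) (c : Finset ι) (U : Finset R)
    (hU : ∀ l ∈ c, (∀ l', v l' = v l → l' = l) → v l ∈ U) :
    2 * Fintype.card R ≤ Fintype.card ι + U.card + cᶜ.card := by
  have h1 : Fintype.card ι = ∑ a, (Finset.univ.filter fun l => v l = a).card :=
    Finset.card_eq_sum_card_fiberwise (fun _ _ => Finset.mem_coe.2 (Finset.mem_univ _))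
  have h2 : cᶜ.card = ∑ a, (cᶜ.filter fun l => v l = a).card :=
    Finset.card_eq_sum_card_fiberwise (fun _ _ => Finset.mem_coe.2 (Finset.mem_univ _))
  have h3 : U.card = ∑ a, if a ∈ U then 1 else 0 := by simp
  rw [h1, h2, h3, ← Finset.sum_add_distrib, ← Finset.sum_add_distrib, mul_comm,
    ← Finset.card_univ, ← smul_eq_mul, ← Finset.sum_const]
  -- Each `a` must be counted twice on the right: its fibre has two elements, or its only element is
  -- in `c`, so that `a ∈ U`, or is in the complement of `c`.
  refine Finset.sum_le_sum fun a _ => ?_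
  obtain ⟨l, rfl⟩ := hv a
  by_cases h : ∃ l', v l' = v l ∧ l' ≠ l
  · obtain ⟨l', h', hne⟩ := h
    have : 1 < (Finset.univ.filter fun k => v k = v l).card :=
      Finset.one_lt_card.2 ⟨l', by simp [h'], l, by simp, hne⟩
    omega
  · push Not at h
    have h4 : 0 < (Finset.univ.filter fun k => v k = v l).card :=
      Finset.card_pos.2 ⟨l, by simp⟩
    by_cases hl : l ∈ c
    · rw [if_pos (hU l hl h)]
      omega
    · have : 0 < (cᶜ.filter fun k => v k = v l).card :=
        Finset.card_pos.2 ⟨l, by simp [hl]⟩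
      omega

/-- Factors with the same index are merged into one function of that coordinate. A merged function
is known to be centered and even when it consists of a single factor from `c`; `u` is the number of
such coordinates. -/
theorem exists_gaussian_index_bound {ι : Type} [Fintype ι] [DecidableEq ι] (F : ι → ℝ → ℝ)
    (c : Finset ι) (hm : ∀ l, Measurable (F l)) {B : ℝ} (hB1 : 1 ≤ B) (hB : ∀ l x, |F l x| ≤ B)
    (hc : ∀ l ∈ c, CenteredEvenFunction (F l)) : ∃ C : ℝ, 0 ≤ C ∧
    ∀ (m n : ℕ) (κ' : ℝ≥0) (A : Matrix (Fin m) (Fin n) ℝ) (ε : ℝ), 0 < ε →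
      Fintype.card ι * ε ≤ 1 / 2 →
      (∀ a b, |((κ' : ℝ) • (A * Aᵀ) - 1 : Matrix (Fin m) (Fin m) ℝ) a b| ≤ ε) →
      ∀ v : ι → Fin m, ∃ u : ℕ,
        2 * (Finset.univ.image v).card ≤ Fintype.card ι + u + cᶜ.card ∧
        |∫ x, ∏ l, F l ((A *ᵥ x) (v l)) ∂(Measure.pi fun _ : Fin n => gaussianReal 0 κ')| ≤
          C * ε ^ u := by
  have hlip : ∀ l, ∃ K : ℝ≥0, l ∈ c → LipschitzWith K (F l) := by
    intro l
    by_cases hl : l ∈ c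
    · obtain ⟨K, hK⟩ := (hc l hl).lipschitz
      exact ⟨K, fun _ => hK⟩
    · exact ⟨0, fun h => absurd h hl⟩
  choose K hK using hlip
  -- A merged function has at most `card ι` factors, each bounded by `B ≥ 1`; the sum of the `K l`
  -- serves as a common Lipschitz constant.
  obtain ⟨C, hC0, hC⟩ := exists_gaussian_prod_bound (Fintype.card ι) (B ^ Fintype.card ι) (∑ l, K l)
  refine ⟨C, hC0, fun m n κ' A ε hε hιε hE v => ?_⟩
  let R : Type := {a // a ∈ Finset.univ.image v}
  let w : ι → R := fun l => ⟨v l, Finset.mem_image_of_mem v (Finset.mem_univ l)⟩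
  have hw : Function.Surjective w := by
    rintro ⟨a, ha⟩
    obtain ⟨l, -, rfl⟩ := Finset.mem_image.1 ha
    exact ⟨l, rfl⟩
  let h : R → ℝ → ℝ := fun a y => ∏ l ∈ Finset.univ.filter (fun l => w l = a), F l y
  let U : Finset R := Finset.univ.filter fun a => ∃ l ∈ c, w l = a ∧ ∀ l', w l' = w l → l' = l
  have hRc : Fintype.card R = (Finset.univ.image v).card := by
    rw [Fintype.card_eq_nat_card]
    exact Nat.card_eq_card_toFinset _ |>.trans (by simp)
  have hU : ∀ a ∈ U, ∃ l ∈ c, h a = F l := by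
    intro a ha
    obtain ⟨l, hl, rfl, huniq⟩ := (Finset.mem_filter.1 ha).2
    refine ⟨l, hl, funext fun y => ?_⟩
    have : Finset.univ.filter (fun k => w k = w l) = {l} := by
      ext k
      simp only [Finset.mem_filter, Finset.mem_univ, true_and, Finset.mem_singleton]
      exact ⟨huniq k, fun hk => by rw [hk]⟩
    simp only [h, this, Finset.prod_singleton]
  refine ⟨U.card, ?_, ?_⟩
  · rw [← hRc]
    exact two_mul_card_le_of_surjective w hw c U fun l hl hu =>
      Finset.mem_filter.2 ⟨Finset.mem_univ _, l, hl, rfl, hu⟩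
  · have hprod : ∀ x : Fin n → ℝ, ∏ l, F l ((A *ᵥ x) (v l)) =
        ∏ a : R, h a ((A.submatrix (fun a : R => a.1) id *ᵥ x) a) := by
      intro x
      rw [← Finset.prod_fiberwise_of_maps_to (g := w) (t := Finset.univ)
        (fun _ _ => Finset.mem_univ _)]
      refine Finset.prod_congr rfl fun a _ => Finset.prod_congr rfl fun l hl => ?_
      rw [← (Finset.mem_filter.1 hl).2]
      rfl
    simp_rw [hprod]
    refine hC R (Fin n) κ' _ ε h U hε ?_ hιε ?_ ?_ ?_ ?_ ?_ ?_
    · rw [hRc]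
      exact Finset.card_image_le
    · intro a b
      have := hE a.1 b.1
      rcases eq_or_ne a b with rfl | hab
      · rw [Matrix.sub_apply, Matrix.one_apply_eq] at this ⊢
        exact this
      · rw [Matrix.sub_apply, Matrix.one_apply_ne fun h => hab (Subtype.ext h)] at this
        rw [Matrix.sub_apply, Matrix.one_apply_ne hab]
        exact this
    · intro a
      exact Finset.measurable_prod _ fun l _ => hm l
    · intro a x
      rw [Finset.abs_prod]
      calc _ ≤ ∏ l ∈ Finset.univ.filter (fun l => w l = a), B :=
            Finset.prod_le_prod (fun _ _ => abs_nonneg _) fun l _ => hB l x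
        _ ≤ _ := by
            rw [Finset.prod_const]
            exact pow_le_pow_right₀ hB1 (Finset.card_le_univ _)
    · intro a ha
      obtain ⟨l, hl, e⟩ := hU a ha
      rw [e]
      exact (hK l hl).weaken (Finset.single_le_sum (f := K) (fun _ _ => zero_le) (Finset.mem_univ l))
    · intro a ha
      obtain ⟨l, hl, e⟩ := hU a ha
      rw [e]
      exact (hc l hl).even
    · intro a ha
      obtain ⟨l, hl, e⟩ := hU a ha
      rw [e]
      exact (hc l hl).centered

/-- The second moment of a weighted sum over index maps of products of functions of a Gaussian
vector with almost independent coordinates. -/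
theorem exists_second_moment_bound {N : ℕ} (f : Fin N → ℝ → ℝ) (c : Finset (Fin N))
    (hm : ∀ l, Measurable (f l)) {B : ℝ} (hB : ∀ l x, |f l x| ≤ B)
    (hc : ∀ l ∈ c, CenteredEvenFunction (f l)) (p : ℕ) (hp : 2 * N ≤ p + c.card + 1) (b : ℝ) :
    ∃ C : ℝ, 0 ≤ C ∧ ∀ (m n : ℕ) (κ' : ℝ≥0) (A : Matrix (Fin m) (Fin n) ℝ) (ε : ℝ), 0 < ε → ε ≤ 1 →
      2 * N * ε ≤ 1 / 2 →
      (∀ i j, |((κ' : ℝ) • (A * Aᵀ) - 1 : Matrix (Fin m) (Fin m) ℝ) i j| ≤ ε) →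
      ∀ W : (Fin N → Fin m) → ℝ, (∀ i, |W i| ≤ b * ε ^ p) →
        ε ^ 2 * ∫ x, (∑ i, W i * ∏ l, f l ((A *ᵥ x) (i l))) ^ 2
          ∂(Measure.pi fun _ : Fin n => gaussianReal 0 κ') ≤
        C * (2 * N + m * ε ^ 2) ^ (2 * N) := by
  let ι := Fin N ⊕ Fin N
  let F : ι → ℝ → ℝ := Sum.elim f f
  have hFm : ∀ l, Measurable (F l) := by rintro (l | l) <;> exact hm l
  have hFB : ∀ l x, |F l x| ≤ max 1 B := by
    rintro (l | l) x <;> exact (hB l x).trans (le_max_right _ _)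
  obtain ⟨C, hC0, hC⟩ := exists_gaussian_index_bound F (c.disjSum c) hFm (le_max_left 1 B) hFB (by
    rintro (l | l) hl
    · exact hc l (Finset.inl_mem_disjSum.1 hl)
    · exact hc l (Finset.inr_mem_disjSum.1 hl))
  have hι : Fintype.card ι = 2 * N := by simp [ι, two_mul]
  refine ⟨b ^ 2 * C, by positivity, fun m n κ' A ε hε hε1 hNε hE W hW => ?_⟩
  set μ := Measure.pi fun _ : Fin n => gaussianReal 0 κ'
  have hAm : Measurable fun x : Fin n → ℝ => A *ᵥ x := by
    unfold Matrix.mulVec dotProduct; fun_prop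
  -- A pair of index maps on `Fin N` is one index map on the disjoint union.
  have hsq : ∀ x : Fin n → ℝ, (∑ i, W i * ∏ l, f l ((A *ᵥ x) (i l))) ^ 2 =
      ∑ v : ι → Fin m, W (v ∘ Sum.inl) * W (v ∘ Sum.inr) * ∏ s, F s ((A *ᵥ x) (v s)) := by
    intro x
    rw [sq, Finset.sum_mul_sum, ← Fintype.sum_prod_type',
      ← (Equiv.sumArrowEquivProdArrow (Fin N) (Fin N) (Fin m)).sum_comp]
    refine Finset.sum_congr rfl fun v _ => ?_
    rw [Fintype.prod_sum_type]
    simp only [Equiv.sumArrowEquivProdArrow, Equiv.coe_fn_mk, F, Sum.elim_inl, Sum.elim_inr,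
      Function.comp_apply]
    simp only [Function.comp_def]
    ring
  have hint : ∀ v : ι → Fin m, Integrable (fun x => ∏ s, F s ((A *ᵥ x) (v s))) μ := by
    intro v
    refine integrable_of_bounded_measurable (C := ∏ _s : ι, max 1 B) ?_ fun x => ?_
    · exact Finset.measurable_prod _ fun s _ =>
        (hFm s).comp ((measurable_pi_apply (v s)).comp hAm)
    · rw [Finset.abs_prod]
      exact Finset.prod_le_prod (fun _ _ => abs_nonneg _) fun s _ => hFB s _
  have hterm : ∀ v : ι → Fin m, ε ^ 2 * (W (v ∘ Sum.inl) * W (v ∘ Sum.inr) *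
      ∫ x, ∏ s, F s ((A *ᵥ x) (v s)) ∂μ) ≤ b ^ 2 * C * (ε ^ 2) ^ (Finset.univ.image v).card := by
    intro v
    obtain ⟨u, hu, hbound⟩ := hC m n κ' A ε hε (by rw [hι]; push_cast; exact hNε) hE v
    have hcc : (c.disjSum c)ᶜ.card = 2 * (N - c.card) := by
      rw [Finset.card_compl, Finset.card_disjSum, hι]
      omega
    have hcN : c.card ≤ N := by simpa using c.card_le_univ
    rw [hcc, hι] at hu
    have h0 : 0 ≤ b * ε ^ p := (abs_nonneg _).trans (hW (v ∘ Sum.inl))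
    have h1 : |W (v ∘ Sum.inl) * W (v ∘ Sum.inr) * ∫ x, ∏ s, F s ((A *ᵥ x) (v s)) ∂μ| ≤
        (b * ε ^ p) * (b * ε ^ p) * (C * ε ^ u) := by
      rw [abs_mul, abs_mul]
      exact mul_le_mul (mul_le_mul (hW _) (hW _) (abs_nonneg _) h0) hbound (abs_nonneg _)
        (mul_nonneg h0 h0)
    -- With `d` distinct values, `hu` gives `u ≥ 2 * d - 4 * N + 2 * c.card`, and `hp` then gives `2
    -- + 2 * p + u ≥ 2 * d`. The `+ 1` in `hp` is paid for by the prefactor `ε ^ 2`.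
    have h2 : ε ^ (2 + 2 * p + u) ≤ ε ^ (2 * (Finset.univ.image v).card) :=
      pow_le_pow_of_le_one hε.le hε1 (by omega)
    calc _ ≤ ε ^ 2 * ((b * ε ^ p) * (b * ε ^ p) * (C * ε ^ u)) :=
          mul_le_mul_of_nonneg_left ((le_abs_self _).trans h1) (by positivity)
      _ = b ^ 2 * C * ε ^ (2 + 2 * p + u) := by ring
      _ ≤ _ := by
          rw [← pow_mul]
          exact mul_le_mul_of_nonneg_left h2 (by positivity)
  simp_rw [hsq]
  rw [integral_finsetSum _ fun v _ => (hint v).const_mul _]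
  simp_rw [integral_const_mul]
  rw [Finset.mul_sum]
  refine (Finset.sum_le_sum fun v _ => hterm v).trans ?_
  rw [← Finset.mul_sum]
  refine mul_le_mul_of_nonneg_left ?_ (by positivity)
  refine (sum_pow_card_image_le (sq_nonneg ε)).trans (le_of_eq ?_)
  rw [hι]
  simp

/-! ### The trace of an alternating product as a sum over index maps -/

/-- The coefficients are products of entries of the `P i`. They are chosen before `d`, so that they
stay constant when the diagonals become random. -/
theorem exists_prod_diagonal_mul_apply {m : ℕ} (P : ℕ → Matrix (Fin m) (Fin m) ℝ) {δ : ℝ}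
    (N s : ℕ) (hP : ∀ i, s ≤ i → i ≤ s + N → ∀ a b, |P i a b| ≤ δ) :
    ∃ V : Fin m → Fin m → (Fin N → Fin m) → ℝ, (∀ a b i, |V a b i| ≤ δ ^ (N + 1)) ∧
      ∀ (d : ℕ → Fin m → ℝ) (a b : Fin m),
        ((List.range' s (N + 1)).map fun i => Matrix.diagonal (d i) * P i).prod a b =
          d s a * ∑ i, V a b i * ∏ l : Fin N, d (s + 1 + l) (i l) := by
  induction N generalizing s with
  | zero =>
    refine ⟨fun a b _ => P s a b, fun a b _ => ?_, fun d a b => ?_⟩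
    · simpa using hP s le_rfl le_rfl a b
    · simp [Matrix.diagonal_mul]
  | succ N ih =>
    obtain ⟨V, hV, h⟩ := ih (s + 1) fun i h1 h2 => hP i (by omega) (by omega)
    refine ⟨fun a b i => P s a (i 0) * V (i 0) b (Fin.tail i), fun a b i => ?_, fun d a b => ?_⟩
    · have h1 := hP s le_rfl (by omega) a (i 0)
      rw [abs_mul, pow_succ']
      exact mul_le_mul h1 (hV _ _ _) (abs_nonneg _) ((abs_nonneg _).trans h1)
    · rw [List.range'_succ, List.map_cons, List.prod_cons, Matrix.mul_apply,
        ← (Fin.consEquiv fun _ => Fin m).sum_comp, Fintype.sum_prod_type, Finset.mul_sum]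
      refine Finset.sum_congr rfl fun c _ => ?_
      rw [h, Matrix.diagonal_mul, mul_assoc, Finset.mul_sum, Finset.mul_sum]
      congr 1
      refine Finset.sum_congr rfl fun i _ => ?_
      simp only [Fin.consEquiv, Equiv.coe_fn_mk, Fin.cons_zero, Fin.tail_cons, Fin.prod_univ_succ,
        Fin.cons_succ, Fin.val_zero, Fin.val_succ, add_zero]
      have : ∀ l : Fin N, s + 1 + ((l : ℕ) + 1) = s + 1 + 1 + l := fun l => by ring
      simp only [this]
      ring

/-- The trace closes the index cycle, so the trailing diagonal `e` acts at the same index as the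
first one. -/
theorem exists_trace_prod_diagonal_mul {m : ℕ} (P : ℕ → Matrix (Fin m) (Fin m) ℝ) {δ : ℝ}
    (N s : ℕ) (hP : ∀ i, s ≤ i → i ≤ s + N → ∀ a b, |P i a b| ≤ δ) :
    ∃ W : (Fin (N + 1) → Fin m) → ℝ, (∀ i, |W i| ≤ δ ^ (N + 1)) ∧
      ∀ (d : ℕ → Fin m → ℝ) (e : Fin m → ℝ),
        (((List.range' s (N + 1)).map fun i => Matrix.diagonal (d i) * P i).prod *
          Matrix.diagonal e).trace =
          ∑ i, W i * ∏ l : Fin (N + 1), (d (s + l) (i l) * if l = 0 then e (i l) else 1) := by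
  obtain ⟨V, hV, h⟩ := exists_prod_diagonal_mul_apply P N s hP
  refine ⟨fun i => V (i 0) (i 0) (Fin.tail i), fun i => hV _ _ _, fun d e => ?_⟩
  rw [Matrix.trace, ← (Fin.consEquiv fun _ => Fin m).sum_comp, Fintype.sum_prod_type]
  refine Finset.sum_congr rfl fun a _ => ?_
  rw [Matrix.diag_apply, Matrix.mul_diagonal, h, Finset.mul_sum, Finset.sum_mul]
  refine Finset.sum_congr rfl fun i _ => ?_
  simp only [Fin.consEquiv, Equiv.coe_fn_mk, Fin.cons_zero, Fin.tail_cons, Fin.prod_univ_succ,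
    Fin.cons_succ, Fin.val_zero, Fin.val_succ, add_zero, if_true, Fin.succ_ne_zero, if_false,
    mul_one]
  have : ∀ l : Fin N, s + ((l : ℕ) + 1) = s + 1 + l := fun l => by ring
  simp only [this]
  ring

theorem mul_prod_map_mul_shift {M : Type*} [Monoid M] (X Y : ℕ → M) (k s : ℕ) :
    X s * ((List.range' s k).map fun i => Y (i + 1) * X (i + 1)).prod =
      ((List.range' s k).map fun i => X i * Y (i + 1)).prod * X (s + k) := by
  induction k generalizing s with
  | zero => simp
  | succ k ih =>
    rw [List.range'_succ, List.map_cons, List.prod_cons, List.map_cons, List.prod_cons, mul_assoc,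
      mul_assoc, ih, mul_assoc, add_right_comm s 1 k, add_assoc s k 1]

/-- The idempotent `G` splits any polynomial into its values at `1 - κ` and `-κ`, with weights `G`
and `1 - G`. Centering ties the two values together, so that only a multiple of `G - κ • 1` remains.
-/
theorem aeval_sub_smul_one_of_idempotent {m : ℕ} {κ : ℝ} {p : ℝ[X]} (hp : CenteredPolynomial κ p)
    {G : Matrix (Fin m) (Fin m) ℝ} (hG : G * G = G) :
    Polynomial.aeval (G - κ • (1 : Matrix (Fin m) (Fin m) ℝ)) p =
      (p.eval (1 - κ) - p.eval (-κ)) • (G - κ • (1 : Matrix (Fin m) (Fin m) ℝ)) := by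
  have key : ∀ p : ℝ[X], Polynomial.aeval (G - κ • (1 : Matrix (Fin m) (Fin m) ℝ)) p =
      p.eval (1 - κ) • G + p.eval (-κ) • (1 - G) := by
    intro p
    induction p using Polynomial.induction_on' with
    | add p q hp hq =>
      rw [map_add, hp, hq, Polynomial.eval_add, Polynomial.eval_add, add_smul, add_smul]
      abel
    | monomial n a =>
      rw [Polynomial.aeval_monomial, Polynomial.eval_monomial, Polynomial.eval_monomial,
        Algebra.algebraMap_eq_smul_one, smul_one_mul, mul_smul, mul_smul, ← smul_add]
      congr 1
      induction n with
      | zero => simp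
      | succ n ih =>
        rw [pow_succ, ih]
        simp only [add_mul, smul_mul_assoc, mul_sub, sub_mul, hG, mul_smul_comm, one_mul, mul_one,
          pow_succ]
        module
  have h : κ * p.eval (1 - κ) + (1 - κ) * p.eval (-κ) = 0 := by
    have := hp
    simpa [CenteredPolynomial, bernoulliExpectation] using this
  have h2 : p.eval (-κ) = -(κ * (p.eval (1 - κ) - p.eval (-κ))) := by linarith
  rw [key]
  generalize p.eval (1 - κ) = a at h2 ⊢
  generalize p.eval (-κ) = b at h2 ⊢
  calc a • G + b • (1 - G) = (a - b) • G + b • (1 : Matrix (Fin m) (Fin m) ℝ) := by module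
    _ = (a - b) • G + (-(κ * (a - b))) • (1 : Matrix (Fin m) (Fin m) ℝ) := by rw [← h2]
    _ = _ := by module

/-- The trace of an alternating product is a sum over index maps of products of functions of the
diagonal entries of `Z`, almost all of which are centered, with small weights. -/
theorem AlternatingProduct.exists_trace_eval_eq {κ : ℝ} (𝒜 : AlternatingProduct κ) :
    ∃ (N : ℕ) (f : Fin N → ℝ → ℝ) (c : Finset (Fin N)) (B b : ℝ) (p : ℕ),
      (∀ l, Measurable (f l)) ∧ (∀ l x, |f l x| ≤ B) ∧ (∀ l ∈ c, CenteredEvenFunction (f l)) ∧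
      2 * N ≤ p + c.card + 1 ∧
      ∀ (m : ℕ) (G : Matrix (Fin m) (Fin m) ℝ) (ε : ℝ), G * G = G →
        (∀ i j, |(G - κ • (1 : Matrix (Fin m) (Fin m) ℝ)) i j| ≤ ε) →
        ∃ W : (Fin N → Fin m) → ℝ, (∀ i, |W i| ≤ b * ε ^ p) ∧ ∀ z : Fin m → ℝ,
          (𝒜.eval (G - κ • (1 : Matrix (Fin m) (Fin m) ℝ)) (Matrix.diagonal z)).trace =
            ∑ i, W i * ∏ l, f l (z (i l)) := by
  obtain ⟨type, k, p, q, hk1, hk2, hp, hq⟩ := 𝒜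
  -- the functions, extended by one at index zero
  let g : ℕ → ℝ → ℝ := fun i => if 1 ≤ i ∧ i ≤ k then q i else fun _ => 1
  have hgq : ∀ i, 1 ≤ i → i ≤ k → g i = q i := fun i h1 h2 => if_pos ⟨h1, h2⟩
  have hg0 : g 0 = fun _ => 1 := if_neg (by omega)
  have hgm : ∀ i, Measurable (g i) := by
    intro i
    by_cases h : 1 ≤ i ∧ i ≤ k
    · obtain ⟨L, hL⟩ := (hq i h.1 h.2).lipschitz
      rw [hgq i h.1 h.2]
      exact hL.continuous.measurable
    · simp only [g, if_neg h]
      exact measurable_const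
  have hgb : ∃ C : ℝ, 1 ≤ C ∧ ∀ i x, |g i x| ≤ C := by
    have : ∀ i, ∃ C : ℝ, ∀ x, 1 ≤ i → i ≤ k → |q i x| ≤ C := by
      intro i
      by_cases h : 1 ≤ i ∧ i ≤ k
      · obtain ⟨C, hC⟩ := (hq i h.1 h.2).bounded
        exact ⟨C, fun x _ _ => hC x⟩
      · exact ⟨0, fun x h1 h2 => absurd ⟨h1, h2⟩ h⟩
    choose C hC using this
    refine ⟨1 + ∑ i ∈ Finset.range (k + 1), |C i|,
      le_add_of_nonneg_right (Finset.sum_nonneg fun _ _ => abs_nonneg _), fun i x => ?_⟩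
    by_cases h : 1 ≤ i ∧ i ≤ k
    · rw [hgq i h.1 h.2]
      have := Finset.single_le_sum (f := fun i => |C i|) (fun _ _ => abs_nonneg _)
        (Finset.mem_range.2 (Nat.lt_succ_of_le h.2))
      linarith [hC i x h.1 h.2, le_abs_self (C i)]
    · simp only [g, if_neg h, abs_one]
      exact le_add_of_nonneg_right (Finset.sum_nonneg fun _ _ => abs_nonneg _)
  obtain ⟨C, hC1, hC⟩ := hgb
  let γ : ℕ → ℝ := fun i => (p i).eval (1 - κ) - (p i).eval (-κ)
  let Γ : ℝ := ∑ i ∈ Finset.range (k + 1), |γ i|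
  have hγ : ∀ i, i ≤ k → |γ i| ≤ Γ := fun i hi =>
    Finset.single_le_sum (f := fun i => |γ i|) (fun _ _ => abs_nonneg _)
      (Finset.mem_range.2 (Nat.lt_succ_of_le hi))
  -- the common part of all nondegenerate cases
  have main : ∀ (s N j : ℕ) (c : Finset (Fin (N + 1))), s + N + 1 ≤ k →
      (∀ l ∈ c, CenteredEvenFunction (fun x => g (s + l) x * if l = 0 then g j x else 1)) →
      N ≤ c.card →
      (∀ (m : ℕ) (Ψ : Matrix (Fin m) (Fin m) ℝ) (z : Fin m → ℝ),
        (∀ i, 1 ≤ i → i ≤ k → Polynomial.aeval Ψ (p i) = γ i • Ψ) →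
        ((AlternatingProduct.mk type k p q hk1 hk2 hp hq : AlternatingProduct κ).eval Ψ
          (Matrix.diagonal z)).trace = (((List.range' s (N + 1)).map fun i =>
            Matrix.diagonal (fun a => g i (z a)) * γ (i + 1) • Ψ).prod *
          Matrix.diagonal fun a => g j (z a)).trace) →
      ∃ (N : ℕ) (f : Fin N → ℝ → ℝ) (c : Finset (Fin N)) (B b : ℝ) (r : ℕ),
        (∀ l, Measurable (f l)) ∧ (∀ l x, |f l x| ≤ B) ∧ (∀ l ∈ c, CenteredEvenFunction (f l)) ∧
        2 * N ≤ r + c.card + 1 ∧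
        ∀ (m : ℕ) (G : Matrix (Fin m) (Fin m) ℝ) (ε : ℝ), G * G = G →
          (∀ i j, |(G - κ • (1 : Matrix (Fin m) (Fin m) ℝ)) i j| ≤ ε) →
          ∃ W : (Fin N → Fin m) → ℝ, (∀ i, |W i| ≤ b * ε ^ r) ∧ ∀ z : Fin m → ℝ,
            ((AlternatingProduct.mk type k p q hk1 hk2 hp hq : AlternatingProduct κ).eval
              (G - κ • (1 : Matrix (Fin m) (Fin m) ℝ)) (Matrix.diagonal z)).trace =
              ∑ i, W i * ∏ l, f l (z (i l)) := by
    intro s N j c hsN hc hcard htrace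
    refine ⟨N + 1, fun l x => g (s + l) x * if l = 0 then g j x else 1, c, C * C, Γ ^ (N + 1),
      N + 1, fun l => ?_, fun l x => ?_, hc, by omega, fun m G ε hG hε => ?_⟩
    · change Measurable fun x => g (s + l) x * if l = 0 then g j x else 1
      split_ifs
      · exact (hgm _).mul (hgm _)
      · exact (hgm _).mul measurable_const
    · rw [abs_mul]
      refine mul_le_mul (hC _ _) ?_ (abs_nonneg _) (by linarith)
      split_ifs
      · exact hC _ _
      · simpa using hC1
    · obtain ⟨W, hW, h⟩ := exists_trace_prod_diagonal_mul
        (fun i => γ (i + 1) • (G - κ • (1 : Matrix (Fin m) (Fin m) ℝ))) (δ := Γ * ε) N s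
        (fun i h1 h2 a b => by
          rw [Matrix.smul_apply, smul_eq_mul, abs_mul]
          exact mul_le_mul (hγ _ (by omega)) (hε a b) (abs_nonneg _)
            ((abs_nonneg _).trans (hγ 0 (by omega))))
      refine ⟨W, fun i => by rw [← mul_pow]; exact hW i, fun z => ?_⟩
      rw [htrace m _ z fun i h1 h2 => aeval_sub_smul_one_of_idempotent (hp i h1 h2) hG, h]
  have hone : ∀ {m : ℕ} (z : Fin m → ℝ), (Matrix.diagonal fun a => g 0 (z a)) = 1 := by
    intro m z
    rw [hg0]
    exact Matrix.diagonal_one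
  have hcent : ∀ i j, 1 ≤ i → i ≤ k → g j = (fun _ => 1) → ∀ {N : ℕ} (l : Fin (N + 1)),
      CenteredEvenFunction (fun x => g i x * if l = 0 then g j x else 1) := by
    intro i j h1 h2 hj N l
    simpa [hj, hgq i h1 h2] using hq i h1 h2
  cases type with
  | one =>
    obtain ⟨N, rfl⟩ : ∃ N, k = N + 1 := ⟨k - 1, by omega⟩
    -- Cyclically, `p 1` and `p k` meet with no function between them; the padding `g 0 = 1` is put
    -- there. It is not centered, so `N` of the `N + 1` slots are, with equality in the count `2 *
    -- (N + 1) ≤ (N + 1) + N + 1`.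
    refine main 0 N 0 (Finset.univ.erase 0) (by omega) ?_ (by simp) ?_
    · intro l hl
      have : (l : ℕ) ≠ 0 := fun h => Finset.ne_of_mem_erase hl (Fin.ext h)
      exact hcent _ _ (by omega) (by omega) hg0 l
    · intro m Ψ z hΨ
      rw [hone, mul_one, List.range'_succ, List.map_cons, List.prod_cons, hone, one_mul]
      simp only [AlternatingProduct.eval, Nat.add_sub_cancel, zero_add]
      rw [hΨ 1 le_rfl hk1]
      congr 3
      refine List.map_congr_left fun i hi => ?_
      obtain ⟨h1, h2⟩ := List.mem_range'_1.1 hi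
      rw [hΨ _ (by omega) (by omega), hgq i (by omega) (by omega)]
      simp [diagApply]
  | two =>
    obtain ⟨N, rfl⟩ : ∃ N, k = N + 1 := ⟨k - 1, by omega⟩
    -- The last function `q k` is carried around the trace to the index of `g 0 = 1`, so every slot
    -- is centered.
    refine main 0 N (N + 1) Finset.univ (by omega) ?_ (by simp) ?_
    · intro l _
      by_cases hl : l = 0
      · subst hl
        simpa [hg0, hgq (N + 1) hk1 le_rfl] using hq (N + 1) hk1 le_rfl
      · have : (l : ℕ) ≠ 0 := fun h => hl (Fin.ext h)
        simpa [hl, hgq l (by omega) (by omega)] using hq l (by omega) (by omega)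
    · intro m Ψ z hΨ
      have := mul_prod_map_mul_shift (fun i => Matrix.diagonal fun a => g i (z a))
        (fun i => γ i • Ψ) (N + 1) 0
      rw [zero_add] at this
      rw [← this, hone, one_mul]
      simp only [AlternatingProduct.eval]
      have e : List.range' 1 (N + 1) = (List.range' 0 (N + 1)).map (1 + ·) := by
        rw [List.map_add_range']
      rw [e, List.map_map]
      congr 2
      refine List.map_congr_left fun i hi => ?_
      obtain ⟨h1, h2⟩ := List.mem_range'_1.1 hi
      simp only [Function.comp_apply, add_comm 1 i]
      rw [hΨ _ (by omega) (by omega), hgq _ (by omega) (by omega)]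
      simp [diagApply]
  | three =>
    -- Here no polynomial occurs and the trace is the sum of the `q 1 (z a)`: one centered slot, no
    -- power of `ε`, and `2 ≤ 0 + 1 + 1`.
    by_cases hk : k = 1
    · subst hk
      obtain ⟨L, hL⟩ := (hq 1 le_rfl le_rfl).lipschitz
      refine ⟨1, fun _ => q 1, Finset.univ, C, 1, 0, fun _ => hL.continuous.measurable,
        fun _ x => ?_, fun _ _ => hq 1 le_rfl le_rfl, by simp, fun m G ε hG hε =>
          ⟨fun _ => 1, fun _ => by simp, fun z => ?_⟩⟩
      · rw [← hgq 1 le_rfl le_rfl]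
        exact hC 1 x
      · simp only [AlternatingProduct.eval, Nat.sub_self, List.range'_zero, List.map_nil,
          List.prod_nil, mul_one, diagApply, Matrix.trace_diagonal, Matrix.diagonal_apply_eq,
          one_mul, Finset.univ_unique, Finset.prod_singleton]
        exact ((Equiv.funUnique (Fin 1) (Fin m)).sum_comp fun a => q 1 (z a)).symm
    · obtain ⟨N, rfl⟩ : ∃ N, k = N + 2 := ⟨k - 2, by omega⟩
      -- The two outer functions `q 1` and `q k` share an index. Their product need not be centered,
      -- so this slot is dropped.
      refine main 1 N (N + 2) (Finset.univ.erase 0) (by omega) ?_ (by simp) ?_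
      · intro l hl
        have hl0 : l ≠ 0 := Finset.ne_of_mem_erase hl
        simpa [hl0, hgq (1 + l) (by omega) (by omega)] using hq (1 + l) (by omega) (by omega)
      · intro m Ψ z hΨ
        have := mul_prod_map_mul_shift (fun i => Matrix.diagonal fun a => g i (z a))
          (fun i => γ i • Ψ) (N + 1) 1
        rw [show 1 + (N + 1) = N + 2 by ring] at this
        rw [← this]
        simp only [AlternatingProduct.eval, Nat.add_one_sub_one]
        congr 2
        · rw [hgq 1 le_rfl (by omega)]
          simp [diagApply]
        · congr 1
          refine List.map_congr_left fun i hi => ?_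
          obtain ⟨h1, h2⟩ := List.mem_range'_1.1 hi
          rw [hΨ _ (by omega) (by omega), hgq _ (by omega) (by omega)]
          simp [diagApply]
  | four =>
    have hk := hk2 rfl
    obtain ⟨N, rfl⟩ : ∃ N, k = N + 2 := ⟨k - 2, by omega⟩
    refine main 1 N 0 Finset.univ (by omega) (fun l _ => ?_) (by simp) ?_
    · exact hcent _ _ (by omega) (by omega) hg0 l
    · intro m Ψ z hΨ
      rw [hone, mul_one]
      simp only [AlternatingProduct.eval, Nat.add_one_sub_one]
      congr 2
      refine List.map_congr_left fun i hi => ?_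
      obtain ⟨h1, h2⟩ := List.mem_range'_1.1 hi
      rw [hΨ _ (by omega) (by omega), hgq _ (by omega) (by omega)]
      simp [diagApply]

/-! ### The Gram matrix of the sensing matrix -/

namespace Realization

variable {m n : ℕ}

theorem A_mul_transpose (ω : Realization m n) :
    ω.A * ω.Aᵀ = (ω.U : Matrix (Fin m) (Fin m) ℝ) *
      Matrix.diagonal (fun k => if (ω.perm k : ℕ) < n then (1 : ℝ) else 0) *
      (ω.U : Matrix (Fin m) (Fin m) ℝ)ᵀ := by
  have h1 : ω.A = (ω.U : Matrix (Fin m) (Fin m) ℝ) *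
      (selectionMatrix m n).submatrix ω.perm id := by
    rw [A, Matrix.mul_assoc]
    congr 1
    exact PEquiv.toMatrix_toPEquiv_mul _ _
  rw [h1, Matrix.transpose_mul, Matrix.mul_assoc, Matrix.mul_assoc, ← Matrix.mul_assoc _ _ (_)ᵀ]
  congr 2
  ext a b
  rw [Matrix.mul_apply, Matrix.diagonal_apply]
  simp only [Matrix.transpose_apply, Matrix.submatrix_apply, selectionMatrix, Matrix.of_apply, id]
  split_ifs with hab h
  · subst hab
    rw [Finset.sum_eq_single ⟨ω.perm a, h⟩]
    · simp
    · intro j _ hj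
      have : (ω.perm a : ℕ) ≠ j := fun e => hj (Fin.ext e.symm)
      simp [this]
    · simp
  · refine Finset.sum_eq_zero fun j _ => ?_
    have : (ω.perm a : ℕ) ≠ j := fun e => h (e ▸ j.2)
    simp [this]
  · refine Finset.sum_eq_zero fun j _ => ?_
    by_cases h1 : (ω.perm a : ℕ) = j
    · have : (ω.perm b : ℕ) ≠ j := fun e => hab (ω.perm.injective (Fin.ext (h1.trans e.symm)))
      simp [this]
    · simp [h1]

theorem A_mul_transpose_idempotent (ω : Realization m n) :
    (ω.A * ω.Aᵀ) * (ω.A * ω.Aᵀ) = ω.A * ω.Aᵀ := by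
  have hU : (ω.U : Matrix (Fin m) (Fin m) ℝ)ᵀ * (ω.U : Matrix (Fin m) (Fin m) ℝ) = 1 :=
    (Matrix.mem_orthogonalGroup_iff' (Fin m) ℝ).1 ω.U.2
  rw [A_mul_transpose]
  set D := Matrix.diagonal (fun k => if (ω.perm k : ℕ) < n then (1 : ℝ) else 0) with hD
  have hDD : D * D = D := by simp [hD]
  calc _ = (ω.U : Matrix (Fin m) (Fin m) ℝ) * D * ((ω.U : Matrix (Fin m) (Fin m) ℝ)ᵀ *
        (ω.U : Matrix (Fin m) (Fin m) ℝ)) * D * (ω.U : Matrix (Fin m) (Fin m) ℝ)ᵀ := by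
        simp only [Matrix.mul_assoc]
    _ = _ := by rw [hU, Matrix.mul_one, Matrix.mul_assoc _ D D, hDD]

/-- Writing `κ • 1` as `κ • (U * Uᵀ)` displays the entry as a sum of centered selection indicators
with weights `U a k * U b k`. -/
theorem Ψ_apply (κ : ℝ) (ω : Realization m n) (a b : Fin m) :
    ω.Ψ κ a b = ∑ k, (ω.U : Matrix (Fin m) (Fin m) ℝ) a k * (ω.U : Matrix (Fin m) (Fin m) ℝ) b k *
      ((if (ω.perm k : ℕ) < n then (1 : ℝ) else 0) - κ) := by
  have hU : (ω.U : Matrix (Fin m) (Fin m) ℝ) * (ω.U : Matrix (Fin m) (Fin m) ℝ)ᵀ = 1 :=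
    (Matrix.mem_orthogonalGroup_iff (Fin m) ℝ).1 ω.U.2
  rw [Ψ, A_mul_transpose, ← hU, Matrix.sub_apply, Matrix.smul_apply, Matrix.mul_apply,
    Matrix.mul_apply, smul_eq_mul, Finset.mul_sum, ← Finset.sum_sub_distrib]
  refine Finset.sum_congr rfl fun k _ => ?_
  rw [Matrix.mul_diagonal, Matrix.transpose_apply]
  ring

end Realization

/-! ### Concentration of sums along a random permutation -/

section Permutation

variable {α : Type*} [Fintype α] [DecidableEq α]

/-- Negative dependence of sampling without replacement. By symmetry the new point may be averaged
over the complement of `S`; once `S` is mapped into `T`, the remaining points hit `T` with frequency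
`(|T| - |S|) / (|α| - |S|)`, at most `|T| / |α|`. -/
theorem sum_perm_prod_indicator_le (T S : Finset α) :
    ∑ σ : Equiv.Perm α, ∏ k ∈ S, (if σ k ∈ T then (1 : ℝ) else 0) ≤
      ((T.card : ℝ) / Fintype.card α) ^ S.card * Fintype.card (Equiv.Perm α) := by
  induction S using Finset.induction_on with
  | empty => simp
  | insert a S ha ih =>
    set τ : ℝ := (T.card : ℝ) / Fintype.card α with hτ
    set ind : α → ℝ := fun j => if j ∈ T then (1 : ℝ) else 0 with hind
    have hcardlt : S.card < Fintype.card α := by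
      have h := Finset.card_le_univ (insert a S)
      rwa [Finset.card_insert_of_notMem ha] at h
    have hsR : (S.card : ℝ) < Fintype.card α := by exact_mod_cast hcardlt
    have hα : (0 : ℝ) < Fintype.card α := lt_of_le_of_lt (Nat.cast_nonneg _) hsR
    have hind0 : ∀ j, 0 ≤ ind j := fun j => by simp only [hind]; split_ifs <;> norm_num
    have hswap : ∀ b ∈ Sᶜ, ∑ σ : Equiv.Perm α, ∏ k ∈ insert b S, ind (σ k) =
        ∑ σ : Equiv.Perm α, ∏ k ∈ insert a S, ind (σ k) := by
      intro b hb
      rw [Finset.mem_compl] at hb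
      refine Fintype.sum_equiv (Equiv.mulRight (Equiv.swap a b)) _ _ fun σ => ?_
      rw [Finset.prod_insert hb, Finset.prod_insert ha]
      simp only [Equiv.coe_mulRight, Equiv.Perm.mul_apply, Equiv.swap_apply_left]
      congr 1
      refine Finset.prod_congr rfl fun k hk => ?_
      rw [Equiv.swap_apply_of_ne_of_ne (by rintro rfl; exact ha hk) (by rintro rfl; exact hb hk)]
    have hsum : ((Fintype.card α : ℝ) - S.card) *
        ∑ σ : Equiv.Perm α, ∏ k ∈ insert a S, ind (σ k) =
        ∑ σ : Equiv.Perm α, (∏ k ∈ S, ind (σ k)) * ∑ b ∈ Sᶜ, ind (σ b) := by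
      have h1 : ((Fintype.card α : ℝ) - S.card) = (Sᶜ.card : ℝ) := by
        rw [Finset.card_compl, Nat.cast_sub hcardlt.le]
      rw [h1, ← nsmul_eq_mul, ← Finset.sum_const, ← Finset.sum_congr rfl hswap, Finset.sum_comm]
      refine Finset.sum_congr rfl fun σ _ => ?_
      rw [Finset.mul_sum]
      refine Finset.sum_congr rfl fun b hb => ?_
      rw [Finset.prod_insert (Finset.mem_compl.1 hb), mul_comm]
    have hpt : ∀ σ : Equiv.Perm α, (∏ k ∈ S, ind (σ k)) * ∑ b ∈ Sᶜ, ind (σ b) ≤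
        (∏ k ∈ S, ind (σ k)) * (τ * (Fintype.card α - S.card)) := by
      intro σ
      by_cases h : ∀ k ∈ S, σ k ∈ T
      · refine mul_le_mul_of_nonneg_left ?_ (Finset.prod_nonneg fun k _ => hind0 _)
        have h1 : ∑ b ∈ S, ind (σ b) + ∑ b ∈ Sᶜ, ind (σ b) = T.card := by
          rw [Finset.sum_add_sum_compl, Equiv.sum_comp σ ind]
          simp [hind]
        have h2 : ∑ b ∈ S, ind (σ b) = S.card := by
          rw [Finset.sum_congr rfl fun k hk => if_pos (h k hk)]
          simp
        have h3 : τ * Fintype.card α = T.card := by rw [hτ]; field_simp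
        have h4 : τ ≤ 1 := by
          rw [hτ, div_le_one hα]
          exact_mod_cast T.card_le_univ
        have h5 : τ * S.card ≤ S.card := mul_le_of_le_one_left (Nat.cast_nonneg _) h4
        linarith
      · push Not at h
        obtain ⟨k, hk, hkT⟩ := h
        have : ∏ k ∈ S, ind (σ k) = 0 := Finset.prod_eq_zero hk (if_neg hkT)
        rw [this, zero_mul, zero_mul]
    have hpos : (0 : ℝ) < Fintype.card α - S.card := by linarith
    have hτ0 : 0 ≤ τ := by positivity
    have hfin : ((Fintype.card α : ℝ) - S.card) *
        ∑ σ : Equiv.Perm α, ∏ k ∈ insert a S, ind (σ k) ≤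
        (Fintype.card α - S.card) * (τ ^ (S.card + 1) * Fintype.card (Equiv.Perm α)) := by
      rw [hsum]
      refine (Finset.sum_le_sum fun σ _ => hpt σ).trans ?_
      rw [← Finset.sum_mul]
      calc _ ≤ τ ^ S.card * Fintype.card (Equiv.Perm α) * (τ * (Fintype.card α - S.card)) :=
            mul_le_mul_of_nonneg_right ih (by positivity)
        _ = _ := by ring
    rw [Finset.card_insert_of_notMem ha]
    exact le_of_mul_le_mul_left hfin hpos

/-- Each exponential is `1 + (exp (x k) - 1)` times an indicator up to a constant. For `x ≥ 0` all
coefficients of the expanded product are nonnegative, so the comparison with independent indicators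
applies termwise; `exp x - 1 ≤ x + x ^ 2` finishes. -/
theorem sum_perm_exp_nonneg_le (T : Finset α) {x : α → ℝ} (h0 : ∀ k, 0 ≤ x k)
    (h1 : ∀ k, x k ≤ 1) :
    ∑ σ : Equiv.Perm α, Real.exp (∑ k, x k * ((if σ k ∈ T then (1 : ℝ) else 0) -
      (T.card : ℝ) / Fintype.card α)) ≤
      Fintype.card (Equiv.Perm α) * Real.exp (∑ k, x k ^ 2) := by
  set τ : ℝ := (T.card : ℝ) / Fintype.card α with hτ
  have hτ0 : 0 ≤ τ := by positivity
  have hτ1 : τ ≤ 1 := div_le_one_of_le₀ (by exact_mod_cast T.card_le_univ) (Nat.cast_nonneg _)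
  have hexp : ∀ σ : Equiv.Perm α, Real.exp (∑ k, x k * ((if σ k ∈ T then (1 : ℝ) else 0) - τ)) =
      Real.exp (-(τ * ∑ k, x k)) *
        ∑ S ∈ Finset.univ.powerset, (∏ k ∈ S, (Real.exp (x k) - 1)) *
          ∏ k ∈ S, (if σ k ∈ T then (1 : ℝ) else 0) := by
    intro σ
    simp_rw [← Finset.prod_mul_distrib]
    rw [← Finset.prod_one_add]
    have : ∀ k, 1 + (Real.exp (x k) - 1) * (if σ k ∈ T then (1 : ℝ) else 0) =
        Real.exp (x k * if σ k ∈ T then (1 : ℝ) else 0) := by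
      intro k
      split_ifs <;> simp
    simp_rw [this]
    rw [← Real.exp_sum, ← Real.exp_add]
    congr 1
    simp_rw [mul_sub]
    rw [Finset.sum_sub_distrib, ← Finset.sum_mul]
    ring
  simp_rw [hexp]
  rw [← Finset.mul_sum, Finset.sum_comm]
  simp_rw [← Finset.mul_sum]
  have hpow : ∑ S ∈ (Finset.univ : Finset α).powerset, (∏ k ∈ S, (Real.exp (x k) - 1)) *
      ∑ σ : Equiv.Perm α, ∏ k ∈ S, (if σ k ∈ T then (1 : ℝ) else 0) ≤
      Fintype.card (Equiv.Perm α) * Real.exp (∑ k, (τ * x k + x k ^ 2)) := by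
    calc _ ≤ ∑ S ∈ (Finset.univ : Finset α).powerset, (∏ k ∈ S, (Real.exp (x k) - 1)) *
          (τ ^ S.card * Fintype.card (Equiv.Perm α)) := by
          refine Finset.sum_le_sum fun S _ => mul_le_mul_of_nonneg_left
            (sum_perm_prod_indicator_le T S) (Finset.prod_nonneg fun k _ => ?_)
          have := Real.one_le_exp (h0 k)
          linarith
      _ = Fintype.card (Equiv.Perm α) * ∏ k, (1 + (Real.exp (x k) - 1) * τ) := by
          rw [Finset.prod_one_add, Finset.mul_sum]
          refine Finset.sum_congr rfl fun S _ => ?_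
          rw [Finset.prod_mul_distrib, Finset.prod_const]
          ring
      _ ≤ _ := by
          refine mul_le_mul_of_nonneg_left ?_ (Nat.cast_nonneg _)
          rw [Real.exp_sum]
          refine Finset.prod_le_prod (fun k _ => ?_) fun k _ => ?_
          · have := Real.one_le_exp (h0 k)
            have : 0 ≤ (Real.exp (x k) - 1) * τ := mul_nonneg (by linarith) hτ0
            linarith
          · have h2 := (abs_le.1 (Real.abs_exp_sub_one_sub_id_le
              (abs_le.2 ⟨by linarith [h0 k], h1 k⟩))).2
            have h3 := Real.add_one_le_exp (τ * x k + x k ^ 2)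
            have h4 : (Real.exp (x k) - 1) * τ ≤ (x k + x k ^ 2) * τ :=
              mul_le_mul_of_nonneg_right (by linarith) hτ0
            have h5 : x k ^ 2 * τ ≤ x k ^ 2 := mul_le_of_le_one_right (sq_nonneg _) hτ1
            linarith
  calc _ ≤ Real.exp (-(τ * ∑ k, x k)) *
        (Fintype.card (Equiv.Perm α) * Real.exp (∑ k, (τ * x k + x k ^ 2))) :=
        mul_le_mul_of_nonneg_left hpow (Real.exp_pos _).le
    _ = _ := by
        rw [mul_left_comm, ← Real.exp_add, Finset.sum_add_distrib, ← Finset.mul_sum]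
        ring_nf

/-- Negative weights on `T` are positive weights on its complement. The two parts are decoupled by
`exp (u + v) ≤ (exp (2u) + exp (2v)) / 2`, whence the range `1 / 2` and the constant `4`. -/
theorem sum_perm_exp_le (T : Finset α) {x : α → ℝ} (hx : ∀ k, |x k| ≤ 1 / 2) :
    ∑ σ : Equiv.Perm α, Real.exp (∑ k, x k * ((if σ k ∈ T then (1 : ℝ) else 0) -
      (T.card : ℝ) / Fintype.card α)) ≤
      Fintype.card (Equiv.Perm α) * Real.exp (4 * ∑ k, x k ^ 2) := by
  rcases isEmpty_or_nonempty α with h | h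
  · simp
  have hα : (0 : ℝ) < Fintype.card α := by exact_mod_cast Fintype.card_pos
  have hp := sum_perm_exp_nonneg_le T (x := fun k => 2 * max (x k) 0)
    (fun k => by positivity) (fun k => by
      have := max_le ((le_abs_self _).trans (hx k)) (by norm_num : (0 : ℝ) ≤ 1 / 2)
      linarith)
  have hn := sum_perm_exp_nonneg_le Tᶜ (x := fun k => 2 * max (-x k) 0)
    (fun k => by positivity) (fun k => by
      have := max_le ((neg_le_abs _).trans (hx k)) (by norm_num : (0 : ℝ) ≤ 1 / 2)
      linarith)
  have hsq : ∀ y : α → ℝ, (∀ k, |y k| ≤ |x k|) → Real.exp (∑ k, (2 * y k) ^ 2) ≤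
      Real.exp (4 * ∑ k, x k ^ 2) := by
    intro y hy
    rw [Finset.mul_sum]
    refine Real.exp_le_exp.2 (Finset.sum_le_sum fun k _ => ?_)
    have := sq_le_sq.2 (hy k)
    nlinarith
  have hp' := hsq (fun k => max (x k) 0) fun k => by
    rw [abs_of_nonneg (le_max_right _ _)]
    exact max_le (le_abs_self _) (abs_nonneg _)
  have hn' := hsq (fun k => max (-x k) 0) fun k => by
    rw [abs_of_nonneg (le_max_right _ _)]
    exact max_le (neg_le_abs _) (abs_nonneg _)
  have hpt : ∀ σ : Equiv.Perm α, Real.exp (∑ k, x k * ((if σ k ∈ T then (1 : ℝ) else 0) -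
      (T.card : ℝ) / Fintype.card α)) ≤
      (Real.exp (∑ k, 2 * max (x k) 0 * ((if σ k ∈ T then (1 : ℝ) else 0) -
        (T.card : ℝ) / Fintype.card α)) +
      Real.exp (∑ k, 2 * max (-x k) 0 * ((if σ k ∈ Tᶜ then (1 : ℝ) else 0) -
        (Tᶜ.card : ℝ) / Fintype.card α))) / 2 := by
    intro σ
    have hadd : ∀ u v : ℝ, Real.exp (u + v) ≤ (Real.exp (2 * u) + Real.exp (2 * v)) / 2 := by
      intro u v
      rw [Real.exp_add, two_mul, two_mul, Real.exp_add, Real.exp_add]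
      nlinarith [sq_nonneg (Real.exp u - Real.exp v)]
    have hTc : (Tᶜ.card : ℝ) / Fintype.card α = 1 - (T.card : ℝ) / Fintype.card α := by
      rw [Finset.card_compl, Nat.cast_sub T.card_le_univ, sub_div, div_self hα.ne']
    refine le_trans (le_of_eq ?_) ((hadd
      (∑ k, max (x k) 0 * ((if σ k ∈ T then (1 : ℝ) else 0) - (T.card : ℝ) / Fintype.card α))
      (∑ k, max (-x k) 0 * ((if σ k ∈ Tᶜ then (1 : ℝ) else 0) -
        (Tᶜ.card : ℝ) / Fintype.card α))).trans (le_of_eq ?_))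
    · rw [← Finset.sum_add_distrib]
      congr 1
      refine Finset.sum_congr rfl fun k _ => ?_
      rw [hTc]
      have : x k = max (x k) 0 - max (-x k) 0 := by
        rcases le_total (x k) 0 with h | h
        · rw [max_eq_right h, max_eq_left (by linarith)]; ring
        · rw [max_eq_left h, max_eq_right (by linarith)]; ring
      generalize max (x k) 0 = u at this ⊢
      generalize max (-x k) 0 = w at this ⊢
      rw [this]
      by_cases hk : σ k ∈ T
      · simp only [Finset.mem_compl, hk, not_true_eq_false, if_true, if_false]
        ring
      · simp only [Finset.mem_compl, hk, not_false_eq_true, if_true, if_false]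
        ring
    · rw [Finset.mul_sum, Finset.mul_sum]
      simp only [mul_assoc]
  refine (Finset.sum_le_sum fun σ _ => hpt σ).trans ?_
  rw [← Finset.sum_div, Finset.sum_add_distrib]
  have hc : (0 : ℝ) ≤ Fintype.card (Equiv.Perm α) := Nat.cast_nonneg _
  have h1 := hp.trans (mul_le_mul_of_nonneg_left hp' hc)
  have h2 := hn.trans (mul_le_mul_of_nonneg_left hn' hc)
  linarith

end Permutation

/-- The exponential Markov inequality for the uniform distribution on a finite type. -/
theorem card_filter_le_of_sum_exp_le {Ω : Type*} [Fintype Ω] (X : Ω → ℝ) (lam t C : ℝ)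
    (hlam : 0 ≤ lam) (h1 : ∑ ω, Real.exp (lam * X ω) ≤ Fintype.card Ω * C)
    (h2 : ∑ ω, Real.exp (-lam * X ω) ≤ Fintype.card Ω * C) :
    ((Finset.univ.filter fun ω => t ≤ |X ω|).card : ℝ) ≤
      Fintype.card Ω * (2 * C * Real.exp (-(lam * t))) := by
  have h3 : ((Finset.univ.filter fun ω => t ≤ |X ω|).card : ℝ) * Real.exp (lam * t) ≤
      ∑ ω, (Real.exp (lam * X ω) + Real.exp (-lam * X ω)) := by
    rw [← nsmul_eq_mul, ← Finset.sum_const]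
    refine (Finset.sum_le_sum fun ω hω => ?_).trans
      (Finset.sum_le_sum_of_subset_of_nonneg (Finset.subset_univ _) fun ω _ _ => by positivity)
    have ht := (Finset.mem_filter.1 hω).2
    rcases le_abs.1 ht with h | h
    · have := Real.exp_le_exp.2 (mul_le_mul_of_nonneg_left h hlam)
      linarith [Real.exp_pos (-lam * X ω)]
    · have := Real.exp_le_exp.2 (mul_le_mul_of_nonneg_left h hlam)
      rw [mul_neg, ← neg_mul] at this
      linarith [Real.exp_pos (lam * X ω)]
  rw [Finset.sum_add_distrib] at h3
  rw [Real.exp_neg, ← mul_assoc, ← div_eq_mul_inv, le_div_iff₀ (Real.exp_pos _)]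
  linarith

theorem card_filter_perm_le {α : Type*} [Fintype α] [DecidableEq α] (T : Finset α) {c : α → ℝ}
    {b lam : ℝ} (hc : ∀ k, |c k| ≤ b) (hlam : 0 ≤ lam) (hb : lam * b ≤ 1 / 2) (t : ℝ) :
    ((Finset.univ.filter fun σ : Equiv.Perm α =>
      t ≤ |∑ k, c k * ((if σ k ∈ T then (1 : ℝ) else 0) - (T.card : ℝ) / Fintype.card α)|).card : ℝ) ≤
      Fintype.card (Equiv.Perm α) *
        (2 * Real.exp (4 * (Fintype.card α * (lam * b) ^ 2)) * Real.exp (-(lam * t))) := by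
  have main : ∀ s : ℝ, |s| = lam → ∑ σ : Equiv.Perm α,
      Real.exp (s * ∑ k, c k * ((if σ k ∈ T then (1 : ℝ) else 0) - (T.card : ℝ) / Fintype.card α)) ≤
      Fintype.card (Equiv.Perm α) * Real.exp (4 * (Fintype.card α * (lam * b) ^ 2)) := by
    intro s hs
    have hsc : ∀ k, |s * c k| ≤ lam * b := fun k => by
      rw [abs_mul, hs]
      exact mul_le_mul_of_nonneg_left (hc k) hlam
    have := sum_perm_exp_le T (x := fun k => s * c k) fun k => (hsc k).trans hb
    simp only [mul_assoc, ← Finset.mul_sum] at this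
    refine this.trans (mul_le_mul_of_nonneg_left (Real.exp_le_exp.2 ?_) (Nat.cast_nonneg _))
    refine mul_le_mul_of_nonneg_left ?_ (by norm_num)
    rw [← Finset.card_univ, ← nsmul_eq_mul, ← Finset.sum_const]
    refine Finset.sum_le_sum fun k _ => sq_le_sq.2 ((hsc k).trans (le_abs_self _))
  exact card_filter_le_of_sum_exp_le _ lam t _ hlam (main lam (abs_of_nonneg hlam))
    (main (-lam) (by rw [abs_neg, abs_of_nonneg hlam]))

/-! ### Rademacher sums -/

theorem sum_exp_rademacher_le {J : Type*} [Fintype J] [DecidableEq J] (a : J → ℝ) (lam : ℝ) :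
    ∑ d : J → Bool, Real.exp (lam * ∑ k, a k * (if d k then 1 else -1)) ≤
      Fintype.card (J → Bool) * Real.exp (lam ^ 2 * (∑ k, a k ^ 2) / 2) := by
  have h1 : ∀ d : J → Bool, Real.exp (lam * ∑ k, a k * (if d k then 1 else -1)) =
      ∏ k, Real.exp (lam * (a k * (if d k then 1 else -1))) := by
    intro d
    rw [Finset.mul_sum, Real.exp_sum]
  simp_rw [h1]
  have h2 := Finset.prod_univ_sum (fun _ : J => (Finset.univ : Finset Bool))
    (fun k b => Real.exp (lam * (a k * (if b then 1 else -1))))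
  rw [Fintype.piFinset_univ] at h2
  rw [← h2]
  have h3 : ∀ k, ∑ b : Bool, Real.exp (lam * (a k * (if b then 1 else -1))) =
      2 * Real.cosh (lam * a k) := by
    intro k
    rw [Fintype.sum_bool, Real.cosh_eq]
    simp
    ring
  simp_rw [h3]
  rw [Finset.prod_mul_distrib, Finset.prod_const, Finset.card_univ]
  have h4 : (Fintype.card (J → Bool) : ℝ) = 2 ^ Fintype.card J := by simp
  rw [h4, Finset.mul_sum, Finset.sum_div, Real.exp_sum]
  refine mul_le_mul_of_nonneg_left (Finset.prod_le_prod (fun k _ => (Real.cosh_pos _).le)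
    fun k _ => ?_) (by positivity)
  refine (Real.cosh_le_exp_half_sq _).trans (le_of_eq ?_)
  rw [mul_pow]

theorem card_filter_rademacher_le {J : Type*} [Fintype J] [DecidableEq J] (a : J → ℝ) {v lam : ℝ}
    (hv : ∑ k, a k ^ 2 ≤ v) (hlam : 0 ≤ lam) (t : ℝ) :
    ((Finset.univ.filter fun d : J → Bool => t ≤ |∑ k, a k * (if d k then 1 else -1)|).card : ℝ) ≤
      Fintype.card (J → Bool) * (2 * Real.exp (lam ^ 2 * v / 2) * Real.exp (-(lam * t))) := by
  have main : ∀ s : ℝ, s ^ 2 = lam ^ 2 →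
      ∑ d : J → Bool, Real.exp (s * ∑ k, a k * (if d k then 1 else -1)) ≤
      Fintype.card (J → Bool) * Real.exp (lam ^ 2 * v / 2) := by
    intro s hs
    refine (sum_exp_rademacher_le a s).trans ?_
    rw [hs]
    gcongr
  exact card_filter_le_of_sum_exp_le _ lam t _ hlam (main lam rfl) (main (-lam) (by ring))

/-! ### Delocalization of Haar distributed orthogonal matrices -/

/-- The Hartley matrix, the real version of the discrete Fourier transform. -/
noncomputable def hartleyMatrix (m : ℕ) : Matrix (Fin m) (Fin m) ℝ :=
  Matrix.of fun j k => (Real.cos (2 * Real.pi * (j * k) / m) + Real.sin (2 * Real.pi * (j * k) / m)) / √m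

theorem sum_exp_two_pi_mul {m : ℕ} (hm : m ≠ 0) (r : ℤ) :
    ∑ k : Fin m, Complex.exp ((2 * Real.pi * (r * k) / m : ℝ) * Complex.I) =
      if (m : ℤ) ∣ r then (m : ℂ) else 0 := by
  have hprim := Complex.isPrimitiveRoot_exp m hm
  set ζ := Complex.exp (2 * Real.pi * Complex.I / m) with hζ
  have hterm : ∀ k : Fin m, Complex.exp ((2 * Real.pi * (r * k) / m : ℝ) * Complex.I) =
      (ζ ^ r) ^ (k : ℕ) := by
    intro k
    rw [hζ, ← Complex.exp_int_mul, ← Complex.exp_nat_mul]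
    congr 1
    push_cast
    ring
  simp_rw [hterm]
  rw [Fin.sum_univ_eq_sum_range fun k => (ζ ^ r) ^ k]
  split_ifs with h
  · rw [(hprim.zpow_eq_one_iff_dvd r).2 h]
    simp
  · have h1 : ζ ^ r ≠ 1 := fun h' => h ((hprim.zpow_eq_one_iff_dvd r).1 h')
    rw [geom_sum_eq h1, ← zpow_natCast, ← zpow_mul, mul_comm, zpow_mul, zpow_natCast,
      hprim.pow_eq_one]
    simp

/-- A product of two entries is a cosine of the difference plus a sine of the sum of the phases;
both are summed by root-of-unity cancellation. This gives a flat orthogonal matrix in every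
dimension. -/
theorem hartleyMatrix_mem_orthogonalGroup {m : ℕ} (hm : m ≠ 0) :
    hartleyMatrix m ∈ Matrix.orthogonalGroup (Fin m) ℝ := by
  rw [Matrix.mem_orthogonalGroup_iff]
  have hm0 : (0 : ℝ) < m := by exact_mod_cast Nat.pos_of_ne_zero hm
  have hre : ∀ r : ℤ, ∑ k : Fin m, Real.cos (2 * Real.pi * (r * k) / m) =
      if (m : ℤ) ∣ r then (m : ℝ) else 0 := by
    intro r
    have := congrArg Complex.re (sum_exp_two_pi_mul hm r)
    simp only [Complex.re_sum, Complex.exp_ofReal_mul_I_re] at this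
    rw [this]
    split_ifs <;> simp
  have him : ∀ r : ℤ, ∑ k : Fin m, Real.sin (2 * Real.pi * (r * k) / m) = 0 := by
    intro r
    have := congrArg Complex.im (sum_exp_two_pi_mul hm r)
    simp only [Complex.im_sum, Complex.exp_ofReal_mul_I_im] at this
    rw [this]
    split_ifs <;> simp
  ext i j
  have hterm : ∀ k : Fin m, hartleyMatrix m i k * (hartleyMatrix m)ᵀ k j =
      (Real.cos (2 * Real.pi * (((i : ℤ) - j : ℤ) * k) / m) +
        Real.sin (2 * Real.pi * (((i : ℤ) + j : ℤ) * k) / m)) / m := by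
    intro k
    rw [Matrix.transpose_apply]
    simp only [hartleyMatrix, Matrix.of_apply]
    rw [div_mul_div_comm, Real.mul_self_sqrt hm0.le]
    congr 1
    have e1 : 2 * Real.pi * (((i : ℤ) - j : ℤ) * k) / m =
        2 * Real.pi * (i * k) / m - 2 * Real.pi * (j * k) / m := by push_cast; ring
    have e2 : 2 * Real.pi * (((i : ℤ) + j : ℤ) * k) / m =
        2 * Real.pi * (i * k) / m + 2 * Real.pi * (j * k) / m := by push_cast; ring
    rw [e1, e2, Real.cos_sub, Real.sin_add]
    ring
  rw [Matrix.mul_apply, Finset.sum_congr rfl fun k _ => hterm k, ← Finset.sum_div,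
    Finset.sum_add_distrib, hre, him, add_zero]
  by_cases h : i = j
  · subst h
    simp [hm0.ne']
  · rw [Matrix.one_apply_ne h, if_neg, zero_div]
    intro hd
    have h1 : ((i : ℤ) - j) = 0 := by
      refine Int.eq_zero_of_abs_lt_dvd hd ?_
      rw [abs_lt]
      have := i.2
      have := j.2
      omega
    exact h (Fin.ext (by omega))

theorem hartleyMatrix_sq_le (m : ℕ) (i j : Fin m) : hartleyMatrix m i j ^ 2 ≤ 2 / m := by
  simp only [hartleyMatrix, Matrix.of_apply, div_pow]
  rw [Real.sq_sqrt (Nat.cast_nonneg _)]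
  refine div_le_div_of_nonneg_right ?_ (Nat.cast_nonneg _)
  set x := 2 * Real.pi * (i * j) / m
  nlinarith [sq_nonneg (Real.cos x - Real.sin x), Real.sin_sq_add_cos_sq x]

instance isProbabilityMeasure_haarOrthogonal (m : ℕ) : IsProbabilityMeasure (haarOrthogonal m) :=
  ⟨Measure.haarMeasure_self⟩

theorem orthogonal_sum_sq_col {m : ℕ} (V : OrthogonalMatrix m) (j : Fin m) :
    ∑ k, (V : Matrix (Fin m) (Fin m) ℝ) k j ^ 2 = 1 := by
  have := congrFun (congrFun ((Matrix.mem_orthogonalGroup_iff' (Fin m) ℝ).1 V.2) j) j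
  rw [Matrix.one_apply_eq] at this
  rw [← this]
  refine Finset.sum_congr rfl fun k _ => ?_
  rw [sq]
  rfl

theorem continuous_orthogonal_apply {m : ℕ} (i j : Fin m) :
    Continuous fun V : OrthogonalMatrix m => (V : Matrix (Fin m) (Fin m) ℝ) i j :=
  continuous_subtype_val.matrix_elem i j

/-- By left invariance the law is unchanged under `V ↦ O d * V` for every sign vector `d`, hence on
averaging over `d`. For fixed `V` each entry of `O d * V` is a Rademacher sum of variance at most `2
/ m`; a union bound over the entries follows. -/
theorem haarOrthogonal_exists_entry_le {m : ℕ} (hm : m ≠ 0) (t : ℝ) :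
    haarOrthogonal m {V | ∃ i j, t ≤ |(V : Matrix (Fin m) (Fin m) ℝ) i j|} ≤
      ENNReal.ofReal (m ^ 2 * (2 * Real.exp 1 * Real.exp (-(√m * t)))) := by
  have hm0 : (0 : ℝ) < m := by exact_mod_cast Nat.pos_of_ne_zero hm
  set r : ℝ := 2 * Real.exp 1 * Real.exp (-(√m * t)) with hr
  have hr0 : 0 ≤ r := by positivity
  let E : Fin m → Fin m → Set (OrthogonalMatrix m) := fun i j =>
    {V | t ≤ |(V : Matrix (Fin m) (Fin m) ℝ) i j|}
  have hE : ∀ i j, MeasurableSet (E i j) := fun i j =>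
    (isClosed_le continuous_const (continuous_orthogonal_apply i j).abs).measurableSet
  let O : (Fin m → Bool) → OrthogonalMatrix m := fun d =>
    ⟨hartleyMatrix m, hartleyMatrix_mem_orthogonalGroup hm⟩ *
      ⟨Matrix.diagonal fun k => if d k then 1 else -1, by
        rw [Matrix.mem_orthogonalGroup_iff, Matrix.diagonal_transpose,
          Matrix.diagonal_mul_diagonal, ← Matrix.diagonal_one]
        congr 1
        ext k
        split_ifs <;> simp⟩
  have hO : ∀ (d : Fin m → Bool) (V : OrthogonalMatrix m) (i j : Fin m),
      ((O d * V : OrthogonalMatrix m) : Matrix (Fin m) (Fin m) ℝ) i j =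
        ∑ k, hartleyMatrix m i k * (V : Matrix (Fin m) (Fin m) ℝ) k j *
          (if d k then 1 else -1) := by
    intro d V i j
    change ((hartleyMatrix m * (Matrix.diagonal fun k => if d k then 1 else -1 :
      Matrix (Fin m) (Fin m) ℝ) * (V : Matrix (Fin m) (Fin m) ℝ) :
      Matrix (Fin m) (Fin m) ℝ)) i j = _
    rw [Matrix.mul_apply]
    refine Finset.sum_congr rfl fun k _ => ?_
    rw [Matrix.mul_diagonal]
    ring
  have hcount : ∀ (V : OrthogonalMatrix m) (i j : Fin m),
      ((Finset.univ.filter fun d => O d * V ∈ E i j).card : ℝ) ≤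
        Fintype.card (Fin m → Bool) * r := by
    intro V i j
    have hv : ∑ k, (hartleyMatrix m i k * (V : Matrix (Fin m) (Fin m) ℝ) k j) ^ 2 ≤ (2 / m : ℝ) := by
      calc _ ≤ ∑ k, 2 / (m : ℝ) * (V : Matrix (Fin m) (Fin m) ℝ) k j ^ 2 := by
            refine Finset.sum_le_sum fun k _ => ?_
            rw [mul_pow]
            exact mul_le_mul_of_nonneg_right (hartleyMatrix_sq_le m i k) (sq_nonneg _)
        _ = (2 / m : ℝ) := by rw [← Finset.mul_sum, orthogonal_sum_sq_col, mul_one]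
    have := card_filter_rademacher_le _ hv (Real.sqrt_nonneg m) t
    -- With `lam = √m` and variance bound `2 / m`, the factor `exp (lam ^ 2 * v / 2)` is the
    -- constant `exp 1`.
    rw [Real.sq_sqrt hm0.le, mul_div_cancel₀ _ hm0.ne', div_self two_ne_zero] at this
    simpa only [E, Set.mem_ofPred_eq, hO] using this
  have hone : ∀ i j, haarOrthogonal m (E i j) ≤ ENNReal.ofReal r := by
    intro i j
    have hinv : ∀ d, haarOrthogonal m (E i j) =
        ∫⁻ V, (E i j).indicator 1 (O d * V) ∂(haarOrthogonal m) := by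
      intro d
      have hp : Measurable fun V : OrthogonalMatrix m => O d * V := measurable_const_mul (O d)
      have : haarOrthogonal m ((fun V => O d * V) ⁻¹' E i j) = haarOrthogonal m (E i j) := by
        unfold haarOrthogonal
        exact measure_preimage_mul _ (O d) (E i j)
      rw [← this, ← lintegral_indicator_one (hp (hE i j))]
      rfl
    have hsum : (Fintype.card (Fin m → Bool) : ENNReal) * haarOrthogonal m (E i j) ≤
        Fintype.card (Fin m → Bool) * ENNReal.ofReal r := by
      calc _ = ∑ d : Fin m → Bool, haarOrthogonal m (E i j) := by
            rw [Finset.sum_const, Finset.card_univ, nsmul_eq_mul]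
        _ = ∫⁻ V, ∑ d : Fin m → Bool, (E i j).indicator 1 (O d * V) ∂(haarOrthogonal m) := by
            rw [lintegral_finsetSum]
            · exact Finset.sum_congr rfl fun d _ => hinv d
            · intro d _
              exact (measurable_one.indicator (hE i j)).comp (measurable_const_mul (O d))
        _ ≤ ∫⁻ _, Fintype.card (Fin m → Bool) * ENNReal.ofReal r ∂(haarOrthogonal m) := by
            refine lintegral_mono fun V => ?_
            have h1 : ∑ d : Fin m → Bool, (E i j).indicator (1 : OrthogonalMatrix m → ENNReal)
                (O d * V) = ((Finset.univ.filter fun d => O d * V ∈ E i j).card : ENNReal) := by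
              classical
              simp [Set.indicator_apply]
            rw [h1, ← ENNReal.ofReal_natCast, ← ENNReal.ofReal_natCast (Fintype.card _),
              ← ENNReal.ofReal_mul (Nat.cast_nonneg _)]
            exact ENNReal.ofReal_le_ofReal (hcount V i j)
        _ = _ := by simp
    refine (ENNReal.mul_le_mul_iff_right ?_ (ENNReal.natCast_ne_top _)).1 hsum
    exact_mod_cast Fintype.card_ne_zero
  have hset : {V : OrthogonalMatrix m | ∃ i j, t ≤ |(V : Matrix (Fin m) (Fin m) ℝ) i j|} =
      ⋃ i, ⋃ j, E i j := by
    ext V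
    simp [E]
  rw [hset]
  calc _ ≤ ∑ i, ∑ j, haarOrthogonal m (E i j) :=
        (measure_iUnion_fintype_le _ _).trans
          (Finset.sum_le_sum fun i _ => measure_iUnion_fintype_le _ _)
    _ ≤ ∑ _i : Fin m, ∑ _j : Fin m, ENNReal.ofReal r :=
        Finset.sum_le_sum fun i _ => Finset.sum_le_sum fun j _ => hone i j
    _ = _ := by
        rw [ENNReal.ofReal_mul (by positivity : (0 : ℝ) ≤ (m : ℝ) ^ 2), ENNReal.ofReal_pow (Nat.cast_nonneg _),
          ENNReal.ofReal_natCast]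
        simp only [Finset.sum_const, Finset.card_univ, Fintype.card_fin, nsmul_eq_mul]
        ring

/-! ### Measurability of the trace -/

theorem measurable_mul_apply {Ω : Type*} [MeasurableSpace Ω] {l m n : ℕ}
    {M : Ω → Matrix (Fin l) (Fin m) ℝ} {M' : Ω → Matrix (Fin m) (Fin n) ℝ}
    (h : ∀ a b, Measurable fun s => M s a b) (h' : ∀ a b, Measurable fun s => M' s a b)
    (a : Fin l) (b : Fin n) : Measurable fun s => (M s * M' s) a b := by
  simp only [Matrix.mul_apply]
  exact Finset.measurable_sum _ fun k _ => (h a k).mul (h' k b)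

theorem measurable_list_prod_apply {Ω : Type*} [MeasurableSpace Ω] {m : ℕ}
    (F : ℕ → Ω → Matrix (Fin m) (Fin m) ℝ) (l : List ℕ)
    (h : ∀ i ∈ l, ∀ a b, Measurable fun s => F i s a b) (a b : Fin m) :
    Measurable fun s => (l.map fun i => F i s).prod a b := by
  induction l generalizing a b with
  | nil => simp
  | cons i l ih =>
    simp only [List.map_cons, List.prod_cons]
    exact measurable_mul_apply (h i List.mem_cons_self)
      (ih fun j hj => h j (List.mem_cons_of_mem _ hj)) a b

theorem measurable_trace_eval {κ : ℝ} (𝒜 : AlternatingProduct κ) (m n : ℕ) :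
    Measurable fun s : OrthogonalMatrix m × Equiv.Perm (Fin m) × (Fin n → ℝ) =>
      (𝒜.eval ((⟨s.1, s.2.1, s.2.2⟩ : Realization m n).Ψ κ)
        (⟨s.1, s.2.1, s.2.2⟩ : Realization m n).Z).trace := by
  let ω : OrthogonalMatrix m × Equiv.Perm (Fin m) × (Fin n → ℝ) → Realization m n :=
    fun s => ⟨s.1, s.2.1, s.2.2⟩
  have hA : ∀ a b, Measurable fun s => (ω s).A a b := by
    refine measurable_mul_apply (measurable_mul_apply (fun a b => ?_) fun a b => ?_)
      fun a b => measurable_const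
    · exact (continuous_orthogonal_apply a b).measurable.comp measurable_fst
    · have h1 : Measurable fun σ : Equiv.Perm (Fin m) => σ.permMatrix ℝ a b :=
        measurable_from_top
      exact h1.comp (measurable_fst.comp measurable_snd)
  have hΨ : ∀ a b, Measurable fun s => (ω s).Ψ κ a b := by
    intro a b
    exact (measurable_mul_apply hA (fun a b => hA b a) a b).sub measurable_const
  have hz : ∀ a, Measurable fun s => ((ω s).A *ᵥ (ω s).x) a := by
    intro a
    simp only [Matrix.mulVec, dotProduct]
    refine Finset.measurable_sum _ fun k _ => (hA a k).mul ?_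
    exact (measurable_pi_apply k).comp (measurable_snd.comp measurable_snd)
  -- Each polynomial of `Ψ` is a fixed multiple of `Ψ`, so no matrix powers have to be handled.
  have hP : ∀ i, 1 ≤ i → i ≤ 𝒜.k → ∀ a b,
      Measurable fun s => Polynomial.aeval ((ω s).Ψ κ) (𝒜.p i) a b := by
    intro i h1 h2 a b
    have h3 : ∀ s, Polynomial.aeval ((ω s).Ψ κ) (𝒜.p i) a b =
        ((𝒜.p i).eval (1 - κ) - (𝒜.p i).eval (-κ)) * (ω s).Ψ κ a b := by
      intro s
      rw [Realization.Ψ, aeval_sub_smul_one_of_idempotent (𝒜.centered_p i h1 h2)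
        (ω s).A_mul_transpose_idempotent, Matrix.smul_apply, smul_eq_mul]
    simp_rw [h3]
    exact (hΨ a b).const_mul _
  have hQ : ∀ i, 1 ≤ i → i ≤ 𝒜.k → ∀ a b,
      Measurable fun s => diagApply (𝒜.q i) (ω s).Z a b := by
    intro i h1 h2 a b
    obtain ⟨L, hL⟩ := (𝒜.centered_q i h1 h2).lipschitz
    simp only [diagApply, Matrix.diagonal_apply, Realization.Z, if_true]
    split_ifs with hab
    · exact hL.continuous.measurable.comp (hz a)
    · exact measurable_const
  have hk := 𝒜.one_le_k
  have heval : ∀ a b, Measurable fun s => 𝒜.eval ((ω s).Ψ κ) (ω s).Z a b := by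
    unfold AlternatingProduct.eval
    cases 𝒜.type
    · refine measurable_mul_apply (hP 1 le_rfl hk) (measurable_list_prod_apply _ _ ?_)
      intro i hi
      obtain ⟨h1, h2⟩ := List.mem_range'_1.1 hi
      exact measurable_mul_apply (hQ i (by omega) (by omega)) (hP (i + 1) (by omega) (by omega))
    · refine measurable_list_prod_apply _ _ ?_
      intro i hi
      obtain ⟨h1, h2⟩ := List.mem_range'_1.1 hi
      exact measurable_mul_apply (hP i (by omega) (by omega)) (hQ i (by omega) (by omega))
    · refine measurable_mul_apply (hQ 1 le_rfl hk) (measurable_list_prod_apply _ _ ?_)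
      intro i hi
      obtain ⟨h1, h2⟩ := List.mem_range'_1.1 hi
      exact measurable_mul_apply (hP (i + 1) (by omega) (by omega))
        (hQ (i + 1) (by omega) (by omega))
    · refine measurable_list_prod_apply _ _ ?_
      intro i hi
      obtain ⟨h1, h2⟩ := List.mem_range'_1.1 hi
      exact measurable_mul_apply (hQ i (by omega) (by omega)) (hP (i + 1) (by omega) (by omega))
  exact Finset.measurable_sum _ fun a _ => heval a a

/-! ### The trace for a fixed delocalized orthogonal matrix -/

theorem uniformOn_univ_le_ofReal {Ω : Type*} [Fintype Ω] [Nonempty Ω] [MeasurableSpace Ω]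
    [MeasurableSingletonClass Ω] (P : Ω → Prop) [DecidablePred P] {r : ℝ}
    (h : ((Finset.univ.filter P).card : ℝ) ≤ Fintype.card Ω * r) :
    uniformOn (Set.univ : Set Ω) {ω | P ω} ≤ ENNReal.ofReal r := by
  have h1 : {ω | P ω} = ((Finset.univ.filter P : Finset Ω) : Set Ω) := by
    ext; simp
  have h0 : (0 : ℝ) < Fintype.card Ω := by exact_mod_cast Fintype.card_pos
  rw [uniformOn_univ, h1, Measure.count_apply_finset]
  refine ENNReal.div_le_of_le_mul ?_
  rw [← ENNReal.ofReal_natCast, ← ENNReal.ofReal_natCast (Fintype.card Ω),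
    ← ENNReal.ofReal_mul' h0.le]
  exact ENNReal.ofReal_le_ofReal (by linarith)

theorem prob_exists_le_abs_Ψ_le {κ : ℝ} {m n : ℕ} (hm : m ≠ 0) (hκ1 : κ ≤ 1)
    (hn : (n : ℝ) = κ * m) (U : OrthogonalMatrix m) (x : Fin n → ℝ) {u lam : ℝ} (hu : 0 ≤ u)
    (hU : ∀ a b, |(U : Matrix (Fin m) (Fin m) ℝ) a b| ≤ u) (hlam : 0 ≤ lam)
    (hlu : lam * u ^ 2 ≤ 1 / 2) (t : ℝ) :
    uniformOn (Set.univ : Set (Equiv.Perm (Fin m)))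
      {σ | ∃ a b, t ≤ |(⟨U, σ, x⟩ : Realization m n).Ψ κ a b|} ≤
      ENNReal.ofReal (m ^ 2 * (2 * Real.exp (4 * (m * (lam * u ^ 2) ^ 2)) *
        Real.exp (-(lam * t)))) := by
  have hm0 : (0 : ℝ) < m := by exact_mod_cast Nat.pos_of_ne_zero hm
  have hnm : n ≤ m := by
    have : (n : ℝ) ≤ m := by rw [hn]; exact mul_le_of_le_one_left hm0.le hκ1
    exact_mod_cast this
  let T : Finset (Fin m) := Finset.univ.filter fun k => (k : ℕ) < n
  have hT : T.card = n := by
    rw [Fin.card_filter_val_lt, min_eq_right hnm]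
  have hTκ : (T.card : ℝ) / Fintype.card (Fin m) = κ := by
    rw [hT, Fintype.card_fin, hn, mul_div_cancel_right₀ _ hm0.ne']
  have hΨ : ∀ (σ : Equiv.Perm (Fin m)) (a b : Fin m), (⟨U, σ, x⟩ : Realization m n).Ψ κ a b =
      ∑ k, (U : Matrix (Fin m) (Fin m) ℝ) a k * (U : Matrix (Fin m) (Fin m) ℝ) b k *
        ((if σ k ∈ T then (1 : ℝ) else 0) - (T.card : ℝ) / Fintype.card (Fin m)) := by
    intro σ a b
    rw [Realization.Ψ_apply, hTκ]
    simp [T]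
  have hone : ∀ a b, ((Finset.univ.filter fun σ : Equiv.Perm (Fin m) =>
      t ≤ |(⟨U, σ, x⟩ : Realization m n).Ψ κ a b|).card : ℝ) ≤
      Fintype.card (Equiv.Perm (Fin m)) * (2 * Real.exp (4 * (m * (lam * u ^ 2) ^ 2)) *
        Real.exp (-(lam * t))) := by
    intro a b
    have := card_filter_perm_le T (c := fun k => (U : Matrix (Fin m) (Fin m) ℝ) a k *
      (U : Matrix (Fin m) (Fin m) ℝ) b k) (b := u ^ 2) (fun k => by
        rw [abs_mul, sq]
        exact mul_le_mul (hU _ _) (hU _ _) (abs_nonneg _) hu) hlam hlu t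
    rw [Fintype.card_fin m] at this
    simp_rw [hΨ, Fintype.card_fin m]
    exact this
  classical
  refine uniformOn_univ_le_ofReal _ ?_
  have hsub : (Finset.univ.filter fun σ : Equiv.Perm (Fin m) =>
      ∃ a b, t ≤ |(⟨U, σ, x⟩ : Realization m n).Ψ κ a b|) ⊆
      (Finset.univ : Finset (Fin m × Fin m)).biUnion fun ab =>
        Finset.univ.filter fun σ => t ≤ |(⟨U, σ, x⟩ : Realization m n).Ψ κ ab.1 ab.2| := by
    intro σ hσ
    obtain ⟨a, b, h⟩ := (Finset.mem_filter.1 hσ).2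
    exact Finset.mem_biUnion.2 ⟨(a, b), Finset.mem_univ _, Finset.mem_filter.2
      ⟨Finset.mem_univ _, h⟩⟩
  have h1 : ((Finset.univ.filter fun σ : Equiv.Perm (Fin m) =>
      ∃ a b, t ≤ |(⟨U, σ, x⟩ : Realization m n).Ψ κ a b|).card : ℝ) ≤
      ∑ ab : Fin m × Fin m, ((Finset.univ.filter fun σ : Equiv.Perm (Fin m) =>
        t ≤ |(⟨U, σ, x⟩ : Realization m n).Ψ κ ab.1 ab.2|).card : ℝ) := by
    exact_mod_cast (Finset.card_le_card hsub).trans Finset.card_biUnion_le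
  refine h1.trans ((Finset.sum_le_sum fun ab _ => hone ab.1 ab.2).trans (le_of_eq ?_))
  simp only [Finset.sum_const, Finset.card_univ, Fintype.card_prod, Fintype.card_fin, nsmul_eq_mul]
  push_cast
  ring

theorem tendsto_natCast_rpow_atTop {s : ℝ} (hs : 0 < s) :
    Tendsto (fun m : ℕ => (m : ℝ) ^ s) atTop atTop :=
  (tendsto_rpow_atTop hs).comp tendsto_natCast_atTop_atTop

theorem tendsto_sq_mul_exp_neg_rpow {c s : ℝ} (hc : 0 < c) (hs : 0 < s) :
    Tendsto (fun m : ℕ => (m : ℝ) ^ 2 * Real.exp (-(c * (m : ℝ) ^ s))) atTop (𝓝 0) := by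
  have h1 := (tendsto_rpow_mul_exp_neg_mul_atTop_nhds_zero (2 / s) c hc).comp
    (tendsto_natCast_rpow_atTop hs)
  refine h1.congr fun m => ?_
  simp only [Function.comp_apply]
  rw [← Real.rpow_mul (Nat.cast_nonneg m), mul_div_cancel₀ _ hs.ne', ← Real.rpow_natCast,
    neg_mul]
  norm_num

theorem tendsto_natCast_rpow_neg {s : ℝ} (hs : s < 0) :
    Tendsto (fun m : ℕ => (m : ℝ) ^ s) atTop (𝓝 0) := by
  have := (tendsto_rpow_neg_atTop (neg_pos.2 hs)).comp tendsto_natCast_atTop_atTop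
  simpa [Function.comp_def] using this

/-- For a delocalized orthogonal matrix, the normalized trace of an alternating product is small
with high probability, at a rate which depends on the dimension only. -/
theorem AlternatingProduct.exists_prob_bound {κ : ℝ} (hκ0 : 0 < κ) (hκ1 : κ < 1)
    (𝒜 : AlternatingProduct κ) : ∃ δ : ℝ, 0 < δ ∧ ∀ ε : ℝ, 0 < ε → ∃ η : ℕ → ℝ,
      Tendsto η atTop (𝓝 0) ∧ ∀ᶠ m : ℕ in atTop, ∀ (n : ℕ), (n : ℝ) = κ * m →
        ∀ U : OrthogonalMatrix m,
          (∀ a b, |(U : Matrix (Fin m) (Fin m) ℝ) a b| ≤ (m : ℝ) ^ ((δ - 1) / 2)) →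
          ((uniformOn (Set.univ : Set (Equiv.Perm (Fin m)))).prod
            (Measure.pi fun _ : Fin n => gaussianReal 0 (Real.toNNReal (1 / κ))))
            {s | ε ≤ |(𝒜.eval ((⟨U, s.1, s.2⟩ : Realization m n).Ψ κ)
              (⟨U, s.1, s.2⟩ : Realization m n).Z).trace / (m : ℝ)|} ≤ ENNReal.ofReal (η m) := by
  obtain ⟨N, f, c, B, b, p, hfm, hfB, hfc, hp, htr⟩ := 𝒜.exists_trace_eval_eq
  obtain ⟨C, hC0, hC⟩ := exists_second_moment_bound f c hfm hfB hfc p hp b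
  -- Small enough that `(m * e ^ 2) ^ (2 * N) = m ^ (8 * N * δ) ≤ m`, and at most `1 / 8`, so that
  -- `2 * δ - 1 / 2 < 0`.
  set δ : ℝ := 1 / (8 * N + 8) with hδ
  have hδ0 : 0 < δ := by positivity
  have hδ8 : δ ≤ 1 / 8 := by
    rw [hδ]
    exact one_div_le_one_div_of_le (by norm_num) (by linarith [(Nat.cast_nonneg N : (0 : ℝ) ≤ N)])
  have hNδ : 8 * N * δ ≤ 1 := by
    rw [hδ, mul_one_div, div_le_one (by positivity)]
    linarith
  -- The first term of the rate is the probability of an atypical permutation, the second the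
  -- Chebyshev bound for a typical one.
  refine ⟨δ, hδ0, fun ε hε => ⟨fun m => 2 * Real.exp 4 * ((m : ℝ) ^ 2 *
    Real.exp (-(κ * (m : ℝ) ^ δ))) + C * (2 * N + 1) ^ (2 * N) / ε ^ 2 * (m : ℝ) ^ (-(4 * δ)),
    ?_, ?_⟩⟩
  · have h1 := (tendsto_sq_mul_exp_neg_rpow hκ0 hδ0).const_mul (2 * Real.exp 4)
    have h2 := (tendsto_natCast_rpow_neg (s := -(4 * δ)) (by linarith)).const_mul
      (C * (2 * N + 1) ^ (2 * N) / ε ^ 2)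
    simpa using h1.add h2
  have hsmall := (tendsto_natCast_rpow_neg (s := 2 * δ - 1 / 2) (by linarith)).const_mul
    (2 * (N : ℝ) + 1)
  rw [mul_zero] at hsmall
  filter_upwards [hsmall.eventually (ge_mem_nhds (show (0 : ℝ) < 1 / 2 by norm_num)),
    eventually_ge_atTop 4] with m hm1 hm4 n hn U hU
  have hm4' : (4 : ℝ) ≤ m := by exact_mod_cast hm4
  have hm0 : (0 : ℝ) < m := by linarith
  have hmne : m ≠ 0 := by omega
  set e : ℝ := (m : ℝ) ^ (2 * δ - 1 / 2) with he
  have he0 : 0 < e := Real.rpow_pos_of_pos hm0 _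
  have hNe : 0 ≤ 2 * (N : ℝ) * e := by positivity
  have he1 : e ≤ 1 := by linarith
  have he2 : 2 * N * e ≤ 1 / 2 := by linarith
  have hme : (m : ℝ) * e ^ 2 = (m : ℝ) ^ (4 * δ) := by
    rw [he, ← Real.rpow_natCast, ← Real.rpow_mul hm0.le]
    conv_lhs => rw [← Real.rpow_one (m : ℝ), ← Real.rpow_mul hm0.le, ← Real.rpow_add hm0]
    congr 1
    push_cast
    ring
  set Q := uniformOn (Set.univ : Set (Equiv.Perm (Fin m))) with hQ
  set γ := Measure.pi fun _ : Fin n => gaussianReal 0 (Real.toNNReal (1 / κ)) with hγ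
  have : IsProbabilityMeasure Q := isProbabilityMeasure_uniformOn Set.finite_univ Set.univ_nonempty
  let bad : Set (Equiv.Perm (Fin m)) :=
    {σ | ∃ a b, κ * e ≤ |(⟨U, σ, 0⟩ : Realization m n).Ψ κ a b|}
  have hbad : Q bad ≤ ENNReal.ofReal (2 * Real.exp 4 * ((m : ℝ) ^ 2 *
      Real.exp (-(κ * (m : ℝ) ^ δ)))) := by
    have hu2 : ((m : ℝ) ^ ((δ - 1) / 2)) ^ 2 = (m : ℝ) ^ (δ - 1) := by
      rw [← Real.rpow_natCast, ← Real.rpow_mul hm0.le]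
      congr 1
      push_cast
      ring
    have hlu : (m : ℝ) ^ (1 / 2 - δ) * ((m : ℝ) ^ ((δ - 1) / 2)) ^ 2 = (m : ℝ) ^ (-(1 / 2) : ℝ) := by
      rw [hu2, ← Real.rpow_add hm0]
      congr 1
      ring
    have hmul : (m : ℝ) * ((m : ℝ) ^ (-(1 / 2) : ℝ)) ^ 2 = 1 := by
      rw [← Real.rpow_natCast, ← Real.rpow_mul hm0.le]
      norm_num
      rw [Real.rpow_neg_one, mul_inv_cancel₀ hm0.ne']
    have hhalf : (m : ℝ) ^ (-(1 / 2) : ℝ) ≤ 1 / 2 := by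
      have h0 : 0 < (m : ℝ) ^ (-(1 / 2) : ℝ) := Real.rpow_pos_of_pos hm0 _
      nlinarith
    have hlt : (m : ℝ) ^ (1 / 2 - δ) * (κ * e) = κ * (m : ℝ) ^ δ := by
      rw [he, mul_left_comm, ← Real.rpow_add hm0]
      congr 2
      ring
    have := prob_exists_le_abs_Ψ_le hmne hκ1.le hn U 0 (Real.rpow_pos_of_pos hm0 _).le hU
      (lam := (m : ℝ) ^ (1 / 2 - δ)) (Real.rpow_pos_of_pos hm0 _).le
      (by rw [hlu]; exact hhalf) (κ * e)
    rw [hlu, hmul, hlt, mul_one] at this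
    refine this.trans (le_of_eq ?_)
    congr 1
    ring
  set r : ℝ := C * (2 * N + 1) ^ (2 * N) / ε ^ 2 * (m : ℝ) ^ (-(4 * δ)) with hr
  have hgood : ∀ σ ∉ bad, γ {x | ε ≤ |(𝒜.eval ((⟨U, σ, x⟩ : Realization m n).Ψ κ)
      (⟨U, σ, x⟩ : Realization m n).Z).trace / (m : ℝ)|} ≤ ENNReal.ofReal r := by
    intro σ hσ
    set A := (⟨U, σ, 0⟩ : Realization m n).A with hA
    have hΨle : ∀ i j, |(A * Aᵀ - κ • (1 : Matrix (Fin m) (Fin m) ℝ)) i j| ≤ κ * e := by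
      intro i j
      by_contra! h
      exact hσ ⟨i, j, h.le⟩
    have hκe : κ * e ≤ e := mul_le_of_le_one_left he0.le hκ1.le
    have hcov : ∀ i j, |(((Real.toNNReal (1 / κ) : ℝ≥0) : ℝ) • (A * Aᵀ) - 1 :
        Matrix (Fin m) (Fin m) ℝ) i j| ≤ e := by
      intro i j
      have h1 : (((Real.toNNReal (1 / κ) : ℝ≥0) : ℝ) • (A * Aᵀ) - 1 :
          Matrix (Fin m) (Fin m) ℝ) =
          (1 / κ) • (A * Aᵀ - κ • (1 : Matrix (Fin m) (Fin m) ℝ)) := by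
        rw [Real.coe_toNNReal _ (by positivity), smul_sub, smul_smul, one_div_mul_cancel hκ0.ne',
          one_smul]
      rw [h1, Matrix.smul_apply, smul_eq_mul, abs_mul, abs_of_pos (by positivity),
        one_div, inv_mul_le_iff₀ hκ0]
      exact hΨle i j
    obtain ⟨W, hW, htrW⟩ := htr m (A * Aᵀ) e
      (⟨U, σ, 0⟩ : Realization m n).A_mul_transpose_idempotent fun i j => (hΨle i j).trans hκe
    have htrace : ∀ x : Fin n → ℝ, (𝒜.eval ((⟨U, σ, x⟩ : Realization m n).Ψ κ)
        (⟨U, σ, x⟩ : Realization m n).Z).trace = ∑ i, W i * ∏ l, f l ((A *ᵥ x) (i l)) :=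
      fun x => htrW (A *ᵥ x)
    have hsecond := hC m n (Real.toNNReal (1 / κ)) A e he0 he1 he2 hcov W hW
    set X : (Fin n → ℝ) → ℝ := fun x => ∑ i, W i * ∏ l, f l ((A *ᵥ x) (i l)) with hX
    have hAm : Measurable fun x : Fin n → ℝ => A *ᵥ x := by
      unfold Matrix.mulVec dotProduct; fun_prop
    have hXm : Measurable X := Finset.measurable_sum _ fun i _ =>
      (Finset.measurable_prod _ fun l _ =>
        (hfm l).comp ((measurable_pi_apply (i l)).comp hAm)).const_mul _
    have hXb : ∀ x, |X x| ≤ ∑ i, |W i| * ∏ _l : Fin N, B := by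
      intro x
      refine (Finset.abs_sum_le_sum_abs _ _).trans (Finset.sum_le_sum fun i _ => ?_)
      rw [abs_mul, Finset.abs_prod]
      exact mul_le_mul_of_nonneg_left
        (Finset.prod_le_prod (fun _ _ => abs_nonneg _) fun l _ => hfB l _) (abs_nonneg _)
    have hX2 : Integrable (fun x => X x ^ 2) γ := by
      refine integrable_of_bounded_measurable (hXm.pow_const 2)
        (C := (∑ i, |W i| * ∏ _l : Fin N, B) ^ 2) fun x => ?_
      rw [abs_pow]
      exact pow_le_pow_left₀ (abs_nonneg _) (hXb x) 2
    have hset : {x | ε ≤ |(𝒜.eval ((⟨U, σ, x⟩ : Realization m n).Ψ κ)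
        (⟨U, σ, x⟩ : Realization m n).Z).trace / (m : ℝ)|} ⊆ {x | (ε * m) ^ 2 ≤ X x ^ 2} := by
      intro x hx
      have hx' : ε ≤ |X x / m| := by
        rw [show X x = _ from (htrace x).symm]
        exact hx
      rw [abs_div, abs_of_pos hm0, le_div_iff₀ hm0] at hx'
      change (ε * m) ^ 2 ≤ X x ^ 2
      rw [← sq_abs (X x)]
      exact pow_le_pow_left₀ (by positivity) hx' 2
    have hmarkov := mul_meas_ge_le_integral_of_nonneg (μ := γ)
      (ae_of_all _ fun x => sq_nonneg (X x)) hX2 ((ε * m) ^ 2)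
    have hbound : ∫ x, X x ^ 2 ∂γ ≤ (ε * m) ^ 2 * r := by
      have hpow : (2 * N + (m : ℝ) * e ^ 2) ^ (2 * N) ≤
          (2 * N + 1) ^ (2 * N) * (m : ℝ) := by
        have h1 : 1 ≤ (m : ℝ) ^ (4 * δ) := Real.one_le_rpow (by linarith) (by linarith)
        rw [hme]
        calc (2 * N + (m : ℝ) ^ (4 * δ)) ^ (2 * N) ≤
              ((2 * N + 1) * (m : ℝ) ^ (4 * δ)) ^ (2 * N) := by
              refine pow_le_pow_left₀ (by positivity) ?_ _
              have : 0 ≤ (2 * N : ℝ) := by positivity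
              nlinarith
          _ = (2 * N + 1) ^ (2 * N) * (m : ℝ) ^ (8 * N * δ) := by
              rw [mul_pow, ← Real.rpow_natCast ((m : ℝ) ^ (4 * δ)), ← Real.rpow_mul hm0.le]
              congr 2
              push_cast
              ring
          _ ≤ _ := by
              refine mul_le_mul_of_nonneg_left ?_ (by positivity)
              conv_rhs => rw [← Real.rpow_one (m : ℝ)]
              exact Real.rpow_le_rpow_of_exponent_le (by linarith) hNδ
      have h2 : e ^ 2 * ∫ x, X x ^ 2 ∂γ ≤ C * ((2 * N + 1) ^ (2 * N) * m) :=
        hsecond.trans (mul_le_mul_of_nonneg_left hpow hC0)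
      -- By `m * e ^ 2 = m ^ (4 * δ)`, the factor `m ^ (-(4 * δ))` in `r` is exactly what remains
      -- after division by `(ε * m) ^ 2`.
      have h3 : e ^ 2 * ((ε * m) ^ 2 * r) = C * ((2 * N + 1) ^ (2 * N) * m) := by
        have h4 : (m : ℝ) ^ (4 * δ) * (m : ℝ) ^ (-(4 * δ)) = 1 := by
          rw [← Real.rpow_add hm0, add_neg_cancel, Real.rpow_zero]
        calc e ^ 2 * ((ε * m) ^ 2 * r) =
            (m * e ^ 2) * (m : ℝ) ^ (-(4 * δ)) * (ε ^ 2 / ε ^ 2) *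
              (C * ((2 * N + 1) ^ (2 * N) * m)) := by rw [hr]; ring
          _ = _ := by rw [hme, h4, div_self (by positivity)]; ring
      exact le_of_mul_le_mul_left (h2.trans h3.ge) (by positivity)
    have hreal : γ.real {x | (ε * m) ^ 2 ≤ X x ^ 2} ≤ r :=
      le_of_mul_le_mul_left (hmarkov.trans hbound) (by positivity)
    refine (measure_mono hset).trans ?_
    rw [← ofReal_measureReal]
    exact ENNReal.ofReal_le_ofReal hreal
  have hSm : MeasurableSet {s : Equiv.Perm (Fin m) × (Fin n → ℝ) |
      ε ≤ |(𝒜.eval ((⟨U, s.1, s.2⟩ : Realization m n).Ψ κ)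
        (⟨U, s.1, s.2⟩ : Realization m n).Z).trace / (m : ℝ)|} :=
    measurableSet_le measurable_const
      ((((measurable_trace_eval 𝒜 m n).comp measurable_prodMk_left).div_const _).abs)
  rw [Measure.prod_apply hSm, ENNReal.ofReal_add (by positivity) (by positivity)]
  calc _ ≤ ∫⁻ σ, (bad.indicator 1 σ + ENNReal.ofReal r) ∂Q := by
        refine lintegral_mono fun σ => ?_
        by_cases hσ : σ ∈ bad
        · rw [Set.indicator_of_mem hσ]
          exact prob_le_one.trans le_self_add
        · rw [Set.indicator_of_notMem hσ, zero_add]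
          exact hgood σ hσ
    _ = (∫⁻ σ, bad.indicator 1 σ ∂Q) + ENNReal.ofReal r := by
        rw [lintegral_add_right _ measurable_const, lintegral_const, measure_univ, mul_one]
    _ ≤ _ := add_le_add_left ((lintegral_indicator_one_le _).trans hbad) _

/-! ### The three models -/

/-- The rate is uniform over delocalized `U`, so by Fubini's theorem it suffices that `U` is
delocalized with probability tending to one. -/
theorem normalizedTraceTendsToZero_of_delocalized {κ : ℝ} (𝒜 : AlternatingProduct κ) {δ : ℝ}
    (hδ : ∀ ε : ℝ, 0 < ε → ∃ η : ℕ → ℝ,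
      Tendsto η atTop (𝓝 0) ∧ ∀ᶠ m : ℕ in atTop, ∀ (n : ℕ), (n : ℝ) = κ * m →
        ∀ U : OrthogonalMatrix m,
          (∀ a b, |(U : Matrix (Fin m) (Fin m) ℝ) a b| ≤ (m : ℝ) ^ ((δ - 1) / 2)) →
          ((uniformOn (Set.univ : Set (Equiv.Perm (Fin m)))).prod
            (Measure.pi fun _ : Fin n => gaussianReal 0 (Real.toNNReal (1 / κ))))
            {s | ε ≤ |(𝒜.eval ((⟨U, s.1, s.2⟩ : Realization m n).Ψ κ)
              (⟨U, s.1, s.2⟩ : Realization m n).Z).trace / (m : ℝ)|} ≤ ENNReal.ofReal (η m))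
    (m n : ℕ → ℕ) (hm : Tendsto m atTop atTop) (hn : ∀ j, (n j : ℝ) = κ * (m j : ℝ))
    (ν : ∀ j, Measure (OrthogonalMatrix (m j))) [∀ j, IsProbabilityMeasure (ν j)]
    (hν : Tendsto (fun j => ν j {V | ∃ a b, ((m j : ℕ) : ℝ) ^ ((δ - 1) / 2) ≤
      |(V : Matrix (Fin (m j)) (Fin (m j)) ℝ) a b|}) atTop (𝓝 0)) :
    NormalizedTraceTendsToZero 𝒜 m n ν := by
  intro ε hε
  obtain ⟨η, hη, hbound⟩ := hδ ε hε
  have hlim : Tendsto (fun j => ν j {V | ∃ a b, ((m j : ℕ) : ℝ) ^ ((δ - 1) / 2) ≤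
      |(V : Matrix (Fin (m j)) (Fin (m j)) ℝ) a b|} + ENNReal.ofReal (η (m j))) atTop (𝓝 0) := by
    have h1 := ENNReal.tendsto_ofReal (hη.comp hm)
    rw [ENNReal.ofReal_zero] at h1
    simpa using hν.add h1
  refine tendsto_of_tendsto_of_tendsto_of_le_of_le' tendsto_const_nhds hlim
    (Eventually.of_forall fun _ => zero_le) ?_
  filter_upwards [hm.eventually hbound] with j hj
  have hQ : IsProbabilityMeasure (uniformOn (Set.univ : Set (Equiv.Perm (Fin (m j))))) :=
    isProbabilityMeasure_uniformOn Set.finite_univ Set.univ_nonempty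
  have hSm : MeasurableSet {s : OrthogonalMatrix (m j) × Equiv.Perm (Fin (m j)) × (Fin (n j) → ℝ) |
      ε ≤ |(𝒜.eval ((⟨s.1, s.2.1, s.2.2⟩ : Realization (m j) (n j)).Ψ κ)
        (⟨s.1, s.2.1, s.2.2⟩ : Realization (m j) (n j)).Z).trace / (m j : ℝ)|} :=
    measurableSet_le measurable_const
      (((measurable_trace_eval 𝒜 (m j) (n j)).div_const _).abs)
  set bad := {V : OrthogonalMatrix (m j) | ∃ a b, ((m j : ℕ) : ℝ) ^ ((δ - 1) / 2) ≤
      |(V : Matrix (Fin (m j)) (Fin (m j)) ℝ) a b|}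
  rw [modelLaw, Measure.prod_apply hSm]
  calc _ ≤ ∫⁻ V, (bad.indicator 1 V + ENNReal.ofReal (η (m j))) ∂(ν j) := by
        refine lintegral_mono fun V => ?_
        by_cases hV : V ∈ bad
        · rw [Set.indicator_of_mem hV]
          exact prob_le_one.trans le_self_add
        · rw [Set.indicator_of_notMem hV, zero_add]
          refine hj (n j) (hn j) V fun a b => ?_
          by_contra! h
          exact hV ⟨a, b, h.le⟩
    _ = (∫⁻ V, bad.indicator 1 V ∂(ν j)) + ENNReal.ofReal (η (m j)) := by
        rw [lintegral_add_right _ measurable_const, lintegral_const, measure_univ, mul_one]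
    _ ≤ _ := add_le_add_left (lintegral_indicator_one_le _) _

/-- Since `√m * m ^ ((δ - 1) / 2) = m ^ (δ / 2)`, the exponential tail beats the `m ^ 2` of the
union bound. -/
theorem tendsto_haarOrthogonal_exists_entry {δ : ℝ} (hδ : 0 < δ) {m : ℕ → ℕ}
    (hm : Tendsto m atTop atTop) :
    Tendsto (fun j => haarOrthogonal (m j) {V | ∃ a b, ((m j : ℕ) : ℝ) ^ ((δ - 1) / 2) ≤
      |(V : Matrix (Fin (m j)) (Fin (m j)) ℝ) a b|}) atTop (𝓝 0) := by
  have h1 := ((tendsto_sq_mul_exp_neg_rpow one_pos (half_pos hδ)).comp hm).const_mul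
    (2 * Real.exp 1)
  have h2 := ENNReal.tendsto_ofReal h1
  rw [mul_zero, ENNReal.ofReal_zero] at h2
  refine tendsto_of_tendsto_of_tendsto_of_le_of_le' tendsto_const_nhds h2
    (Eventually.of_forall fun _ => zero_le) ?_
  filter_upwards [hm.eventually (eventually_ge_atTop 1)] with j hj
  have hj0 : (0 : ℝ) < m j := by exact_mod_cast hj
  refine (haarOrthogonal_exists_entry_le (by omega) _).trans (le_of_eq ?_)
  have h3 : √(m j : ℝ) * ((m j : ℕ) : ℝ) ^ ((δ - 1) / 2) = 1 * (m j : ℝ) ^ (δ / 2) := by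
    rw [Real.sqrt_eq_rpow, ← Real.rpow_add hj0, one_mul]
    congr 1
    ring
  rw [h3]
  simp only [Function.comp_apply]
  congr 1
  ring

theorem measurableSet_exists_entry {m : ℕ} (t : ℝ) :
    MeasurableSet {V : OrthogonalMatrix m | ∃ a b, t ≤ |(V : Matrix (Fin m) (Fin m) ℝ) a b|} := by
  have : {V : OrthogonalMatrix m | ∃ a b, t ≤ |(V : Matrix (Fin m) (Fin m) ℝ) a b|} =
      ⋃ a, ⋃ b, {V : OrthogonalMatrix m | t ≤ |(V : Matrix (Fin m) (Fin m) ℝ) a b|} := by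
    ext V
    simp
  rw [this]
  exact MeasurableSet.iUnion fun a => MeasurableSet.iUnion fun b =>
    (isClosed_le continuous_const (continuous_orthogonal_apply a b).abs).measurableSet

/-- Powers of the logarithm are eventually below `m ^ δ`, so the event eventually has probability
exactly zero. -/
theorem tendsto_dirac_exists_entry {δ : ℝ} (hδ : 0 < δ) {m : ℕ → ℕ}
    (hm : Tendsto m atTop atTop) (U : ∀ j, OrthogonalMatrix (m j)) (K₁ K₂ K₃ : ℝ)
    (hU : ∀ j, K₃ ≤ (m j : ℝ) → ∀ a b : Fin (m j),
      |(U j : Matrix (Fin (m j)) (Fin (m j)) ℝ) a b| ≤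
        √(K₁ * Real.log (m j : ℝ) ^ K₂ / (m j : ℝ))) :
    Tendsto (fun j => Measure.dirac (U j) {V | ∃ a b, ((m j : ℕ) : ℝ) ^ ((δ - 1) / 2) ≤
      |(V : Matrix (Fin (m j)) (Fin (m j)) ℝ) a b|}) atTop (𝓝 0) := by
  have hmR : Tendsto (fun j => (m j : ℝ)) atTop atTop := tendsto_natCast_atTop_atTop.comp hm
  have hlog : ∀ᶠ x : ℝ in atTop, K₁ * Real.log x ^ K₂ < x ^ δ := by
    have h1 := ((isLittleO_log_rpow_rpow_atTop K₂ hδ).const_mul_left K₁).def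
      (show (0 : ℝ) < 1 / 2 by norm_num)
    filter_upwards [h1, eventually_gt_atTop 0] with x hx hx0
    have h2 : 0 < x ^ δ := Real.rpow_pos_of_pos hx0 _
    rw [Real.norm_eq_abs, Real.norm_eq_abs, abs_of_pos h2] at hx
    linarith [le_abs_self (K₁ * Real.log x ^ K₂)]
  refine tendsto_const_nhds.congr' ?_
  filter_upwards [hmR.eventually hlog, hmR.eventually (eventually_ge_atTop K₃),
    hmR.eventually (eventually_gt_atTop 0)] with j h1 h2 h3
  rw [Measure.dirac_apply' _ (measurableSet_exists_entry _), Set.indicator_of_notMem]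
  rintro ⟨a, b, h⟩
  have h4 := h.trans (hU j h2 a b)
  have h5 : ((m j : ℕ) : ℝ) ^ ((δ - 1) / 2) = √((m j : ℝ) ^ δ / m j) := by
    rw [Real.sqrt_eq_rpow, ← Real.rpow_sub_one h3.ne', ← Real.rpow_mul h3.le]
    congr 1
    ring
  rw [h5] at h4
  have h6 : √(K₁ * Real.log (m j : ℝ) ^ K₂ / (m j : ℝ)) < √((m j : ℝ) ^ δ / m j) :=
    (Real.sqrt_lt_sqrt_iff_of_pos (by positivity)).2 (div_lt_div_of_pos_right h1 h3)
  linarith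

theorem abs_hadamardWalsh_apply (ℓ : ℕ) (a b : Fin (2 ^ ℓ)) :
    |hadamardWalsh ℓ a b| = √(1 / ((2 ^ ℓ : ℕ) : ℝ)) := by
  simp only [hadamardWalsh, Matrix.of_apply]
  rw [abs_div, abs_pow, abs_neg, abs_one, one_pow, abs_of_nonneg (Real.sqrt_nonneg _),
    Real.sqrt_div zero_le_one, Real.sqrt_one]


theorem proposition3p1 (κ : ℝ) (hκ0 : 0 < κ) (hκ1 : κ < 1) (𝒜 : AlternatingProduct κ) :
    -- sub-sampled Haar sensing model
    (∀ m n : ℕ → ℕ, Tendsto m atTop atTop → (∀ j, (n j : ℝ) = κ * (m j : ℝ)) →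
      NormalizedTraceTendsToZero 𝒜 m n (fun j => haarOrthogonal (m j))) ∧
    -- sub-sampled Hadamard sensing model
    (∀ ℓ n : ℕ → ℕ, Tendsto ℓ atTop atTop → (∀ j, (n j : ℝ) = κ * ((2 ^ ℓ j : ℕ) : ℝ)) →
      NormalizedTraceTendsToZero 𝒜 (fun j => 2 ^ ℓ j) n
        (fun j => Measure.dirac (hadamardOrthogonal (ℓ j)))) ∧
    -- sub-sampling deterministic delocalized orthogonal matrices
    (∀ (m n : ℕ → ℕ) (U : ∀ j, OrthogonalMatrix (m j)) (K₁ K₂ K₃ : ℝ),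
      Tendsto m atTop atTop → (∀ j, (n j : ℝ) = κ * (m j : ℝ)) →
      (∀ j, K₃ ≤ (m j : ℝ) → ∀ a b : Fin (m j),
        |(U j : Matrix (Fin (m j)) (Fin (m j)) ℝ) a b| ≤
          √(K₁ * Real.log (m j : ℝ) ^ K₂ / (m j : ℝ))) →
      NormalizedTraceTendsToZero 𝒜 m n (fun j => Measure.dirac (U j))) := by
  obtain ⟨δ, hδ0, hδ⟩ := 𝒜.exists_prob_bound hκ0 hκ1
  refine ⟨fun m n hm hn => ?_, fun ℓ n hℓ hn => ?_, fun m n U K₁ K₂ K₃ hm hn hU => ?_⟩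
  · exact normalizedTraceTendsToZero_of_delocalized 𝒜 hδ m n hm hn _
      (tendsto_haarOrthogonal_exists_entry hδ0 hm)
  · have hm : Tendsto (fun j => 2 ^ ℓ j) atTop atTop :=
      (tendsto_pow_atTop_atTop_of_one_lt one_lt_two).comp hℓ
    -- All entries have modulus `1 / √m`: the deterministic case with constants `1, 0, 0`.
    refine normalizedTraceTendsToZero_of_delocalized 𝒜 hδ (fun j => 2 ^ ℓ j) n hm hn _
      (tendsto_dirac_exists_entry hδ0 hm (fun j => hadamardOrthogonal (ℓ j)) 1 0 0
        fun j _ a b => ?_)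
    rw [Real.rpow_zero, one_mul]
    exact (abs_hadamardWalsh_apply (ℓ j) a b).le
  · exact normalizedTraceTendsToZero_of_delocalized 𝒜 hδ m n hm hn _
      (tendsto_dirac_exists_entry hδ0 hm U K₁ K₂ K₃ hU)
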